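/- Let $\sigma\in\{1,-1\}$, let $2\le p\le n$ be integers, and let $b_p,\dots,b_n$ be real numbers with $b_p<0$. Consider, in cylindrical coordinates $(r,\varphi,z)$ on $\mathbb{R}^3$, the system $$\dot r=\sigma r^3,\qquad \dot\varphi=1,\qquad \dot z=b_pz^p+b_{p+1}z^{p+1}+\dots+b_nz^n$$ (this is the reduced normal form $\dot r=\sigma r\bigl(r^{2l}+\sum_{i=0}^{l-1}a_ir^{2i}\bigr)$, $\dot\varphi=1$, $\dot z=b_2z^2+\dots+b_nz^n$ with $l=1$, $a_0=0$ and first nonzero coefficient $b_p$ in the $z$-equation). By a spatial spiral trajectory near the origin we mean the set $\Gamma\subset\mathbb{R}^3$ traced by a solution with $r>0$ over a time half-line $[t_0,\infty)$ or $(-\infty,t_0]$ that tends to the origin as $t\to\infty$, respectively $t\to-\infty$, and that is not contained in the invariant plane $z=0$. Then every spatial spiral trajectory $\Gamma$ near the origin is bounded, its lower and upper box dimensions coincide, and (i) if $2\le p\le 3$, then $\dim_B\Gamma=\frac43$; (ii) if $p\ge4$, then $\dim_B\Gamma=\frac32-\frac1{2p}$. Moreover, there is $\delta>0$ such that a spatial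 spiral trajectory near the origin passes through every point $(r_0,\varphi_0,z_0)$ with $0<r_0<\delta$, $|z_0|<\delta$ and $\sigma b_pz_0^{p-1}>0$; in particular, for $\sigma=-1$, through every point with $0<r_0<\delta$, $0<z_0<\delta$. Here, for bounded $A\subset\mathbb{R}^N$ with open $\varepsilon$-neighbourhood $A_\varepsilon$ of Lebesgue measure $|A_\varepsilon|$, the lower and upper box dimensions are the infima of those $s\ge0$ for which $\liminf_{\varepsilon\to0^+}|A_\varepsilon|/\varepsilon^{N-s}=0$, respectively $\limsup_{\varepsilon\to0^+}|A_\varepsilon|/\varepsilon^{N-s}=0$; $\dim_BA$ is their common value. -/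

import Mathlib

open Filter Topology MeasureTheory

noncomputable section

/-- Lower `s`-dimensional Minkowski content of `A ⊆ ℝ^N`:
`liminf_{ε → 0+} |A_ε| / ε^(N - s)`, where `A_ε` is the open `ε`-neighbourhood. -/
def lowerMinkowskiContent {N : ℕ} (s : ℝ) (A : Set (EuclideanSpace ℝ (Fin N))) : ENNReal :=
  liminf (fun ε : ℝ => volume (Metric.thickening ε A) / ENNReal.ofReal (ε ^ ((N : ℝ) - s)))
    (𝓝[>] 0)

/-- Upper `s`-dimensional Minkowski content of `A ⊆ ℝ^N`. -/
def upperMinkowskiContent {N : ℕ} (s : ℝ) (A : Set (EuclideanSpace ℝ (Fin N))) : ENNReal :=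
  limsup (fun ε : ℝ => volume (Metric.thickening ε A) / ENNReal.ofReal (ε ^ ((N : ℝ) - s)))
    (𝓝[>] 0)

/-- Lower box dimension of a bounded set. -/
def lowerBoxDim {N : ℕ} (A : Set (EuclideanSpace ℝ (Fin N))) : ℝ :=
  sInf {s : ℝ | 0 ≤ s ∧ lowerMinkowskiContent s A = 0}

/-- Upper box dimension of a bounded set. -/
def upperBoxDim {N : ℕ} (A : Set (EuclideanSpace ℝ (Fin N))) : ℝ :=
  sInf {s : ℝ | 0 ≤ s ∧ upperMinkowskiContent s A = 0}

/-- `A` is bounded and its lower and upper box dimensions coincide and equal `d`. -/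
def HasBoxDim {N : ℕ} (A : Set (EuclideanSpace ℝ (Fin N))) (d : ℝ) : Prop :=
  Bornology.IsBounded A ∧ lowerBoxDim A = d ∧ upperBoxDim A = d

/-- The point of `ℝ³` with cylindrical coordinates `(r, φ, z)`. -/
def cylPoint (r φ z : ℝ) : EuclideanSpace ℝ (Fin 3) :=
  !₂[r * Real.cos φ, r * Real.sin φ, z]

/-- `(r, φ, z)` solves, on the time interval `J` and away from the axis `r = 0`, the system
`r' = σ r (r^(2l) + ∑_{i<l} a_i r^(2i))`, `φ' = 1`, `z' = b_2 z^2 + ⋯ + b_n z^n`. -/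
structure IsReducedSolution (σ : ℝ) (l : ℕ) (a : Fin l → ℝ) (n : ℕ) (b : ℕ → ℝ)
    (J : Set ℝ) (r φ z : ℝ → ℝ) : Prop where
  r_pos : ∀ t ∈ J, 0 < r t
  deriv_r : ∀ t ∈ J, HasDerivWithinAt r
    (σ * (r t * (r t ^ (2 * l) + ∑ i : Fin l, a i * r t ^ (2 * (i : ℕ))))) J t
  deriv_φ : ∀ t ∈ J, HasDerivWithinAt φ 1 J t
  deriv_z : ∀ t ∈ J, HasDerivWithinAt z (∑ i ∈ Finset.Icc 2 n, b i * z t ^ i) J t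

/-- `Γ ⊆ ℝ³` is a half-trajectory of the system (traced over `[t₀, ∞)` or over `(-∞, t₀]`) that
tends to the origin, lies off the axis `r = 0`, and is not contained in the invariant plane
`z = 0`. -/
def IsSpatialSpiral (σ : ℝ) (l : ℕ) (a : Fin l → ℝ) (n : ℕ) (b : ℕ → ℝ)
    (Γ : Set (EuclideanSpace ℝ (Fin 3))) : Prop :=
  ∃ (J : Set ℝ) (F : Filter ℝ) (r φ z : ℝ → ℝ),
    ((∃ t₀, J = Set.Ici t₀ ∧ F = atTop) ∨ (∃ t₀, J = Set.Iic t₀ ∧ F = atBot)) ∧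
    IsReducedSolution σ l a n b J r φ z ∧
    Tendsto (fun t => cylPoint (r t) (φ t) (z t)) F (𝓝 0) ∧
    (∃ t ∈ J, z t ≠ 0) ∧
    Γ = (fun t => cylPoint (r t) (φ t) (z t)) '' J

end

/-! Parametrise the trajectory by `s ≥ 1` so that it tends to the origin as `s → ∞`. Both scalar
equations have the form `w' = w ^ k * H` with `H` tending to a nonzero limit, so `r` decays like `s
^ (-1/2)` and `|z|` like `s ^ (-1/(p-1))`, with derivatives of order `s ^ (-3/2)` and `s ^
(-1-1/(p-1))` (`abs_asymptotics_of_deriv_eq_pow_mul`). As `φ' = ±1`, consecutive windings near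
parameter `s` are about `s ^ (-1-β)` apart, where `β = min (1/(p-1)) (1/2)`: the slower coordinate
decides.

At scale `ε` the windings merge at the critical parameter `T` with `T ^ (-1-β) ≈ ε`. Put `R = √T ≈ ε
^ (-e)`, `e = 1/(2(1+β))`. The strand before `T` has length about `∫ s ^ (-1/2) ds ≈ R` and needs
about `R/ε` balls. The rest lies on a surface of revolution whose meridian has length `O(T ^ (-β)) =
O(ε R²)` and whose circles have radius `O(1/R)`; it needs about `R² * (1/(ε R)) = R/ε` balls as well
(`volume_thickening_spiral_le`). Conversely, on a parameter range comparable to `T` one finds about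
`R/ε` points of the curve that are `2ε`-separated (`le_volume_thickening_spiral`). Hence the
`ε`-neighbourhood has volume of order `ε³ R/ε = ε ^ (2-e)`, and the dimension is `1 + e`.

Existence of spirals through given points is separation of variables: each coordinate solves a
scalar equation and, in the right time direction, decays to zero (`exists_decaying_solution`). -/

/-! ### Box dimension from volume bounds, nets and separated points -/

/-- Two-sided power bounds on the volume of the `ε`-neighbourhoods determine the box dimension. -/
theorem hasBoxDim_of_volume_bounds {N : ℕ} {A : Set (EuclideanSpace ℝ (Fin N))} {d c C : ℝ}
    (hA : Bornology.IsBounded A) (hd : 0 ≤ d) (hc : 0 < c)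
    (hlow : ∀ᶠ ε : ℝ in 𝓝[>] 0,
      ENNReal.ofReal (c * ε ^ ((N : ℝ) - d)) ≤ volume (Metric.thickening ε A))
    (hup : ∀ᶠ ε : ℝ in 𝓝[>] 0,
      volume (Metric.thickening ε A) ≤ ENNReal.ofReal (C * ε ^ ((N : ℝ) - d))) :
    HasBoxDim A d := by
  have hpos : ∀ᶠ ε : ℝ in 𝓝[>] 0, 0 < ε := eventually_mem_nhdsWithin
  have hlt1 : ∀ᶠ ε : ℝ in 𝓝[>] 0, ε < 1 := nhdsWithin_le_nhds (eventually_lt_nhds one_pos)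
  have hup0 : ∀ s, d < s → upperMinkowskiContent s A = 0 := by
    intro s hs
    refine Tendsto.limsup_eq ?_
    have h1 : Tendsto (fun ε : ℝ => ENNReal.ofReal (C * ε ^ (s - d))) (𝓝[>] 0) (𝓝 0) := by
      have h2 : Tendsto (fun ε : ℝ => C * ε ^ (s - d)) (𝓝[>] 0) (𝓝 (C * 0 ^ (s - d))) :=
        ((Real.continuousAt_rpow_const 0 (s - d) (Or.inr (by linarith))).tendsto.mono_left
          nhdsWithin_le_nhds).const_mul C
      rw [Real.zero_rpow (by linarith), mul_zero] at h2
      simpa using (ENNReal.tendsto_ofReal h2)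
    refine tendsto_of_tendsto_of_tendsto_of_le_of_le' tendsto_const_nhds h1
      (Eventually.of_forall fun _ => zero_le) ?_
    filter_upwards [hup, hpos] with ε h hε
    calc _ ≤ ENNReal.ofReal (C * ε ^ ((N : ℝ) - d)) / ENNReal.ofReal (ε ^ ((N : ℝ) - s)) := by
          gcongr
      _ = ENNReal.ofReal (C * ε ^ (s - d)) := by
          rw [← ENNReal.ofReal_div_of_pos (by positivity), mul_div_assoc, ← Real.rpow_sub hε]
          congr 3; ring
  have hlow0 : ∀ s, lowerMinkowskiContent s A = 0 → d ≤ s := by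
    intro s h0
    by_contra! hs
    have : ENNReal.ofReal c ≤ lowerMinkowskiContent s A := by
      refine le_liminf_of_le (by isBoundedDefault) ?_
      filter_upwards [hlow, hpos, hlt1] with ε h hε h1
      calc ENNReal.ofReal c ≤ ENNReal.ofReal (c * ε ^ (s - d)) := by
            apply ENNReal.ofReal_le_ofReal
            have := Real.one_le_rpow_of_pos_of_le_one_of_nonpos hε h1.le
              (by linarith : s - d ≤ 0)
            nlinarith
        _ = ENNReal.ofReal (c * ε ^ ((N : ℝ) - d)) / ENNReal.ofReal (ε ^ ((N : ℝ) - s)) := by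
            rw [← ENNReal.ofReal_div_of_pos (by positivity), mul_div_assoc, ← Real.rpow_sub hε]
            congr 3; ring
        _ ≤ _ := by gcongr
    rw [h0] at this
    exact absurd this (not_le.2 (ENNReal.ofReal_pos.2 hc))
  have hle : ∀ s, lowerMinkowskiContent s A ≤ upperMinkowskiContent s A := fun s =>
    liminf_le_limsup (by isBoundedDefault) (by isBoundedDefault)
  have key : ∀ S : Set ℝ, (∀ s, d < s → s ∈ S) → (∀ s ∈ S, d ≤ s) → sInf S = d := by
    intro S h1 h2
    refine le_antisymm (le_of_forall_gt_imp_ge_of_dense fun s hs => csInf_le ⟨d, h2⟩ (h1 s hs))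
      (le_csInf ⟨d + 1, h1 _ (by linarith)⟩ h2)
  refine ⟨hA, key _ (fun s hs => ⟨by linarith, ?_⟩) fun s hs => hlow0 s hs.2,
    key _ (fun s hs => ⟨by linarith, hup0 s hs⟩) fun s hs => hlow0 s ?_⟩
  · exact le_antisymm ((hle s).trans (hup0 s hs).le) zero_le
  · exact le_antisymm ((hle s).trans hs.2.le) zero_le

/-- A bounded real function on `I` admits a finite net of controlled size. -/
theorem exists_finset_net {ι : Type*} (I : Set ι) (g : ι → ℝ) {L ε : ℝ} (hε : 0 < ε)
    (hL : 0 ≤ L) (hg : ∀ t ∈ I, 0 ≤ g t ∧ g t ≤ L) :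
    ∃ F : Finset ι, (F.card : ℝ) ≤ L / ε + 1 ∧ (∀ s ∈ F, s ∈ I) ∧
      ∀ t ∈ I, ∃ s ∈ F, |g t - g s| ≤ ε := by
  classical
  rcases I.eq_empty_or_nonempty with rfl | ⟨i₀, hi₀⟩
  · exact ⟨∅, by simp; positivity, by simp, by simp⟩
  -- One representative for each bucket `[j ε, (j+1) ε)` of values of `g`; empty buckets receive the
  -- default `i₀`.
  have hex : ∀ j : ℕ, ∃ s ∈ I, (∃ t ∈ I, ⌊g t / ε⌋₊ = j) → ⌊g s / ε⌋₊ = j := by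
    intro j
    by_cases h : ∃ t ∈ I, ⌊g t / ε⌋₊ = j
    · obtain ⟨t, ht, h⟩ := h
      exact ⟨t, ht, fun _ => h⟩
    · exact ⟨i₀, hi₀, fun h' => absurd h' h⟩
  choose f hfI hf using hex
  refine ⟨(Finset.range (⌊L / ε⌋₊ + 1)).image f, ?_, ?_, ?_⟩
  · have h1 : ((Finset.range (⌊L / ε⌋₊ + 1)).image f).card ≤ ⌊L / ε⌋₊ + 1 := by
      simpa using Finset.card_image_le (s := Finset.range (⌊L / ε⌋₊ + 1)) (f := f)
    have h2 : (⌊L / ε⌋₊ : ℝ) ≤ L / ε := Nat.floor_le (by positivity)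
    have h3 : (((Finset.range (⌊L / ε⌋₊ + 1)).image f).card : ℝ) ≤ (⌊L / ε⌋₊ : ℝ) + 1 := by
      exact_mod_cast h1
    linarith
  · intro s hs
    obtain ⟨j, _, rfl⟩ := Finset.mem_image.1 hs
    exact hfI j
  · intro t ht
    refine ⟨f ⌊g t / ε⌋₊, Finset.mem_image_of_mem _ ?_, ?_⟩
    · rw [Finset.mem_range, Nat.lt_succ_iff]
      exact Nat.floor_le_floor (by have := (hg t ht).2; gcongr)
    · have he := hf _ ⟨t, ht, rfl⟩
      set s := f ⌊g t / ε⌋₊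
      have a1 := Nat.floor_le (div_nonneg (hg t ht).1 hε.le)
      have a2 := Nat.lt_floor_add_one (g t / ε)
      have a3 := Nat.floor_le (div_nonneg (hg s (hfI _)).1 hε.le)
      have a4 := Nat.lt_floor_add_one (g s / ε)
      rw [he] at a3 a4
      have : |g t / ε - g s / ε| ≤ 1 := by rw [abs_le]; constructor <;> linarith
      rwa [← sub_div, abs_div, abs_of_pos hε, div_le_one hε] at this

/-- A set with a finite `K ε`-net has `ε`-neighbourhood of controlled volume. -/
theorem volume_thickening_le_of_net {A : Set (EuclideanSpace ℝ (Fin 3))}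
    (F : Finset (EuclideanSpace ℝ (Fin 3))) {ε K n : ℝ} (hε : 0 < ε) (hK : 0 ≤ K)
    (hF : (F.card : ℝ) ≤ n) (hA : ∀ x ∈ A, ∃ y ∈ F, dist x y ≤ K * ε) :
    volume (Metric.thickening ε A) ≤ ENNReal.ofReal (n * ((K + 1) * ε) ^ 3) *
      volume (Metric.ball (0 : EuclideanSpace ℝ (Fin 3)) 1) := by
  have hsub : Metric.thickening ε A ⊆ ⋃ y ∈ F, Metric.ball y ((K + 1) * ε) := by
    intro x hx
    obtain ⟨a, ha, hxa⟩ := Metric.mem_thickening_iff.1 hx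
    obtain ⟨y, hy, hay⟩ := hA a ha
    refine Set.mem_iUnion₂.2 ⟨y, hy, ?_⟩
    rw [Metric.mem_ball]
    linarith [dist_triangle x a y]
  calc _ ≤ volume (⋃ y ∈ F, Metric.ball y ((K + 1) * ε)) := measure_mono hsub
    _ ≤ ∑ y ∈ F, volume (Metric.ball y ((K + 1) * ε)) := measure_biUnion_finset_le _ _
    _ = ∑ y ∈ F, ENNReal.ofReal (((K + 1) * ε) ^ 3) *
          volume (Metric.ball (0 : EuclideanSpace ℝ (Fin 3)) 1) := by
        refine Finset.sum_congr rfl fun y _ => ?_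
        rw [Measure.addHaar_ball volume y (by positivity)]
        simp
    _ = ENNReal.ofReal (F.card * ((K + 1) * ε) ^ 3) *
          volume (Metric.ball (0 : EuclideanSpace ℝ (Fin 3)) 1) := by
        rw [Finset.sum_const, nsmul_eq_mul, ENNReal.ofReal_mul (by positivity),
          ENNReal.ofReal_natCast, mul_assoc]
    _ ≤ _ := by gcongr

/-- A finite family of `2 ε`-separated points of `A` bounds the volume of the
`ε`-neighbourhood of `A` from below. -/
theorem le_volume_thickening_of_separated {ι : Type*} {A : Set (EuclideanSpace ℝ (Fin 3))}
    (F : Finset ι) (x : ι → EuclideanSpace ℝ (Fin 3)) {ε n : ℝ} (hε : 0 < ε)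
    (hF : n ≤ F.card) (hA : ∀ i ∈ F, x i ∈ A)
    (hsep : ∀ i ∈ F, ∀ j ∈ F, i ≠ j → 2 * ε ≤ dist (x i) (x j)) :
    ENNReal.ofReal (n * ε ^ 3) * volume (Metric.ball (0 : EuclideanSpace ℝ (Fin 3)) 1) ≤
      volume (Metric.thickening ε A) := by
  have hsub : (⋃ i ∈ F, Metric.ball (x i) ε) ⊆ Metric.thickening ε A := by
    refine Set.iUnion₂_subset fun i hi y hy => ?_
    exact Metric.mem_thickening_iff.2 ⟨x i, hA i hi, hy⟩
  calc _ ≤ ENNReal.ofReal (F.card * ε ^ 3) *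
          volume (Metric.ball (0 : EuclideanSpace ℝ (Fin 3)) 1) := by gcongr
    _ = ∑ i ∈ F, ENNReal.ofReal (ε ^ 3) *
          volume (Metric.ball (0 : EuclideanSpace ℝ (Fin 3)) 1) := by
        rw [Finset.sum_const, nsmul_eq_mul, ENNReal.ofReal_mul (by positivity),
          ENNReal.ofReal_natCast, mul_assoc]
    _ = ∑ i ∈ F, volume (Metric.ball (x i) ε) := by
        refine Finset.sum_congr rfl fun i _ => ?_
        rw [Measure.addHaar_ball volume (x i) hε.le]
        simp
    _ = volume (⋃ i ∈ F, Metric.ball (x i) ε) := by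
        refine (measure_biUnion_finset (fun i hi j hj hij => ?_) fun i _ => measurableSet_ball).symm
        exact Metric.ball_disjoint_ball (by linarith [hsep i hi j hj hij])
    _ ≤ _ := measure_mono hsub

/-! ### Distances in cylindrical coordinates -/

theorem dist_cylPoint_sq (r₁ φ₁ z₁ r₂ φ₂ z₂ : ℝ) :
    dist (cylPoint r₁ φ₁ z₁) (cylPoint r₂ φ₂ z₂) ^ 2 =
      (r₁ * Real.cos φ₁ - r₂ * Real.cos φ₂) ^ 2 + (r₁ * Real.sin φ₁ - r₂ * Real.sin φ₂) ^ 2 +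
        (z₁ - z₂) ^ 2 := by
  rw [EuclideanSpace.dist_eq, Real.sq_sqrt (by positivity)]
  simp [Fin.sum_univ_three, cylPoint, Real.dist_eq, sq_abs]

theorem norm_cylPoint_sq (r φ z : ℝ) : ‖cylPoint r φ z‖ ^ 2 = r ^ 2 + z ^ 2 := by
  rw [EuclideanSpace.norm_eq, Real.sq_sqrt (by positivity)]
  simp [Fin.sum_univ_three, cylPoint, sq_abs]
  linear_combination r ^ 2 * Real.sin_sq_add_cos_sq φ

theorem norm_cylPoint_le (r φ z : ℝ) : ‖cylPoint r φ z‖ ≤ |r| + |z| := by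
  refine abs_le_of_sq_le_sq' ?_ (by positivity) |>.2
  rw [norm_cylPoint_sq]
  nlinarith [sq_abs r, sq_abs z, mul_nonneg (abs_nonneg r) (abs_nonneg z)]

theorem abs_le_norm_cylPoint (r φ z : ℝ) : |r| ≤ ‖cylPoint r φ z‖ ∧ |z| ≤ ‖cylPoint r φ z‖ := by
  constructor <;> refine abs_le_of_sq_le_sq ?_ (norm_nonneg _) <;> rw [norm_cylPoint_sq] <;>
    nlinarith [sq_nonneg r, sq_nonneg z]

/-- By the law of cosines the horizontal part of the squared distance is `(r₁ - r₂)² + 2 r₁ r₂ (1 -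
cos Δφ)`. Since `r₁ r₂ ≤ |r₂| |r₁ - r₂| + r₂²`, the mixed term is absorbed using `1 - cos x ≤ |x|`
on the first summand and `1 - cos x ≤ x²/2` on the second. -/
theorem dist_cylPoint_le (r₁ φ₁ z₁ r₂ φ₂ z₂ : ℝ) :
    dist (cylPoint r₁ φ₁ z₁) (cylPoint r₂ φ₂ z₂) ≤
      |r₁ - r₂| + |r₂| * |φ₁ - φ₂| + |z₁ - z₂| := by
  refine abs_le_of_sq_le_sq' ?_ (by positivity) |>.2
  have hcos : 1 - (φ₁ - φ₂) ^ 2 / 2 ≤ Real.cos (φ₁ - φ₂) := Real.one_sub_sq_div_two_le_cos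
  have e : dist (cylPoint r₁ φ₁ z₁) (cylPoint r₂ φ₂ z₂) ^ 2 =
      (r₁ - r₂) ^ 2 + 2 * (r₁ * r₂) * (1 - Real.cos (φ₁ - φ₂)) + (z₁ - z₂) ^ 2 := by
    rw [dist_cylPoint_sq, Real.cos_sub]
    linear_combination r₁ ^ 2 * Real.sin_sq_add_cos_sq φ₁ + r₂ ^ 2 * Real.sin_sq_add_cos_sq φ₂
  have h1 := Real.cos_le_one (φ₁ - φ₂)
  have hr : r₁ * r₂ ≤ |r₂| * |r₁ - r₂| + |r₂| ^ 2 := by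
    have : r₁ * r₂ = (r₁ - r₂) * r₂ + r₂ ^ 2 := by ring
    rw [this, sq_abs, mul_comm |r₂|, ← abs_mul]
    linarith [le_abs_self ((r₁ - r₂) * r₂)]
  have h2 : 1 - Real.cos (φ₁ - φ₂) ≤ |φ₁ - φ₂| := by
    have := Real.abs_sin_le_one ((φ₁ - φ₂) / 2)
    have h3 : |Real.sin ((φ₁ - φ₂) / 2)| ≤ |φ₁ - φ₂| / 2 := by
      have := Real.abs_sin_le_abs (x := (φ₁ - φ₂) / 2)
      rwa [abs_div, abs_two] at this
    have h4 : 1 - Real.cos (φ₁ - φ₂) = 2 * |Real.sin ((φ₁ - φ₂) / 2)| ^ 2 := by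
      rw [sq_abs, Real.sin_sq_eq_half_sub]
      ring_nf
    rw [h4]
    nlinarith [abs_nonneg (Real.sin ((φ₁ - φ₂) / 2))]
  have h5 : 1 - Real.cos (φ₁ - φ₂) ≤ |φ₁ - φ₂| ^ 2 / 2 := by rw [sq_abs]; linarith
  have h6 : 2 * (r₁ * r₂) * (1 - Real.cos (φ₁ - φ₂)) ≤
      2 * (|r₂| * |r₁ - r₂|) * |φ₁ - φ₂| + |r₂| ^ 2 * |φ₁ - φ₂| ^ 2 := by
    have p1 : 0 ≤ |r₂| * |r₁ - r₂| := by positivity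
    have p2 : 0 ≤ |r₂| ^ 2 := by positivity
    nlinarith [mul_le_mul_of_nonneg_right hr (by linarith : 0 ≤ 1 - Real.cos (φ₁ - φ₂)),
      mul_le_mul_of_nonneg_left h2 p1, mul_le_mul_of_nonneg_left h5 p2]
  rw [e, ← sq_abs (r₁ - r₂), ← sq_abs (z₁ - z₂)]
  have p3 : 0 ≤ |r₁ - r₂| * |z₁ - z₂| := by positivity
  have p4 : 0 ≤ |r₂| * |φ₁ - φ₂| * |z₁ - z₂| := by positivity
  nlinarith

theorem le_dist_cylPoint_of_same_angle {r₁ φ₁ z₁ r₂ φ₂ z₂ : ℝ}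
    (hc : Real.cos φ₁ = Real.cos φ₂) (hs : Real.sin φ₁ = Real.sin φ₂) :
    (|r₁ - r₂| + |z₁ - z₂|) / 2 ≤ dist (cylPoint r₁ φ₁ z₁) (cylPoint r₂ φ₂ z₂) := by
  refine abs_le_of_sq_le_sq' ?_ dist_nonneg |>.2
  have e : dist (cylPoint r₁ φ₁ z₁) (cylPoint r₂ φ₂ z₂) ^ 2 =
      |r₁ - r₂| ^ 2 + |z₁ - z₂| ^ 2 := by
    rw [dist_cylPoint_sq, hc, hs, sq_abs, sq_abs]
    linear_combination (r₁ - r₂) ^ 2 * Real.sin_sq_add_cos_sq φ₂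
  rw [e]
  nlinarith [sq_nonneg (|r₁ - r₂| - |z₁ - z₂|), sq_nonneg |r₁ - r₂|, sq_nonneg |z₁ - z₂|]

/-- `|r₁ sin (φ₁ - φ₂)|` is the distance from the first point to the vertical plane through the axis
at angle `φ₂`, which contains the second point. -/
theorem abs_mul_sin_le_dist_cylPoint (r₁ φ₁ z₁ r₂ φ₂ z₂ : ℝ) :
    |r₁| * |Real.sin (φ₁ - φ₂)| ≤ dist (cylPoint r₁ φ₁ z₁) (cylPoint r₂ φ₂ z₂) := by
  rw [← abs_mul]
  refine abs_le_of_sq_le_sq ?_ dist_nonneg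
  rw [dist_cylPoint_sq]
  have e : r₁ * Real.sin (φ₁ - φ₂) = (r₁ * Real.sin φ₁ - r₂ * Real.sin φ₂) * Real.cos φ₂ -
      (r₁ * Real.cos φ₁ - r₂ * Real.cos φ₂) * Real.sin φ₂ := by
    rw [Real.sin_sub]; ring
  rw [e]
  set a := r₁ * Real.cos φ₁ - r₂ * Real.cos φ₂
  set b := r₁ * Real.sin φ₁ - r₂ * Real.sin φ₂
  have : a ^ 2 + b ^ 2 = (b * Real.cos φ₂ - a * Real.sin φ₂) ^ 2 +
      (a * Real.cos φ₂ + b * Real.sin φ₂) ^ 2 := by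
    linear_combination (-(a ^ 2 + b ^ 2)) * Real.sin_sq_add_cos_sq φ₂
  nlinarith [sq_nonneg (a * Real.cos φ₂ + b * Real.sin φ₂), sq_nonneg (z₁ - z₂)]

/-! ### Upper volume bound for a spiral -/

/-- Lets a net in the variable `√s`, which measures arc length, control the meridian profile too.
The left side is `s ^ (-β) * (1 - (t/s) ^ (-β))`, where the first factor is at most `1` and the
second at most `1 - √s/√t`. -/
theorem rpow_neg_sub_rpow_neg_le_sqrt_sub {β s t : ℝ} (hβ : 0 ≤ β) (hβ' : β ≤ 1 / 2) (hs : 1 ≤ s)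
    (hst : s ≤ t) : s ^ (-β) - t ^ (-β) ≤ √t - √s := by
  have hs0 : 0 < s := by linarith
  have ht0 : 0 < t := by linarith
  have h1 : s ^ (-β) ≤ 1 := Real.rpow_le_one_of_one_le_of_nonpos hs (by linarith)
  have h2 : t ^ (-β) = s ^ (-β) * (t / s) ^ (-β) := by
    rw [← Real.mul_rpow hs0.le (by positivity), mul_div_cancel₀ _ hs0.ne']
  have hq : 1 ≤ t / s := (one_le_div hs0).2 hst
  have h3 : √s / √t ≤ (t / s) ^ (-β) := by
    calc √s / √t = (t / s) ^ (-(1 / 2) : ℝ) := by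
          rw [Real.rpow_neg (by positivity), ← Real.sqrt_eq_rpow, Real.sqrt_div' _ hs0.le, inv_div]
      _ ≤ _ := Real.rpow_le_rpow_of_exponent_le hq (by linarith)
  have hss : √s ≤ √t := Real.sqrt_le_sqrt hst
  have hs1 : 1 ≤ √s := Real.one_le_sqrt.2 hs
  have h4 : 1 - √s / √t ≤ √t - √s := by
    have : 1 - √s / √t = (√t - √s) / √t := by field_simp
    rw [this]
    exact div_le_self (by linarith) (by linarith)
  have h5 : √s / √t ≤ 1 := (div_le_one (by linarith)).2 hss
  have h6 : 0 < s ^ (-β) := Real.rpow_pos_of_pos hs0 _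
  rw [h2]
  nlinarith [mul_le_mul_of_nonneg_left h3 h6.le]

theorem exists_mem_Icc_cylPoint_eq (r φ z : ℝ) :
    ∃ ψ ∈ Set.Icc 0 (2 * Real.pi), cylPoint r φ z = cylPoint r ψ z := by
  have hpi := Real.two_pi_pos
  have := toIcoMod_mem_Ico hpi 0 φ
  refine ⟨toIcoMod hpi 0 φ, ⟨this.1, by linarith [this.2]⟩, ?_⟩
  have h : toIcoMod hpi 0 φ = φ - toIcoDiv hpi 0 φ * (2 * Real.pi) := by
    rw [toIcoMod, zsmul_eq_mul]
  simp only [cylPoint, h, Real.cos_sub_int_mul_two_pi, Real.sin_sub_int_mul_two_pi]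

/-- Upper bound for the volume of the neighbourhoods of a spiral of radius `O(s ^ (-1/2))` whose
meridian profile varies at most as `s ^ (-β)`. -/
theorem volume_thickening_spiral_le {r φ z : ℝ → ℝ} {β C : ℝ} (hβ : 0 < β) (hβ' : β ≤ 1 / 2)
    (hC : 0 < C) (hr : ∀ s, 1 ≤ s → |r s| ≤ C / √s)
    (hdr : ∀ s t, 1 ≤ s → s ≤ t → |r s - r t| ≤ C * (s ^ (-β) - t ^ (-β)))
    (hdz : ∀ s t, 1 ≤ s → s ≤ t → |z s - z t| ≤ C * (s ^ (-β) - t ^ (-β)))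
    (hφ : ∀ s t, 1 ≤ s → 1 ≤ t → |φ s - φ t| ≤ |s - t|) :
    ∃ C' : ℝ, ∀ ε : ℝ, 0 < ε → ε ≤ 1 →
      volume (Metric.thickening ε ((fun s => cylPoint (r s) (φ s) (z s)) '' Set.Ici 1)) ≤
        ENNReal.ofReal (C' * ε ^ (2 - 1 / (2 * (1 + β)))) := by
  classical
  set v := volume (Metric.ball (0 : EuclideanSpace ℝ (Fin 3)) 1) with hv
  have hvtop : v ≠ ⊤ := measure_ball_lt_top.ne
  refine ⟨18 * (4 * C + 1) ^ 3 * v.toReal, fun ε hε hε1 => ?_⟩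
  set e := 1 / (2 * (1 + β)) with he
  have he0 : 0 < e := by positivity
  set R := ε ^ (-e) with hR
  have hR1 : 1 ≤ R := Real.one_le_rpow_of_pos_of_le_one_of_nonpos hε hε1 (by linarith)
  have hR0 : 0 < R := by linarith
  have hsq : √(R ^ 2) = R := Real.sqrt_sq hR0.le
  have hT1 : 1 ≤ R ^ 2 := by nlinarith
  -- `T = R ^ 2 = ε ^ (-1/(1+β))` is the critical parameter: this is `T ^ (-1-β) = ε` multiplied by
  -- `T`.
  have hTβ : (R ^ 2) ^ (-β) = ε * R ^ 2 := by
    have hRR : R ^ 2 = ε ^ (-e * 2) := by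
      rw [hR, ← Real.rpow_natCast, ← Real.rpow_mul hε.le]; norm_num
    rw [hRR, ← Real.rpow_mul hε.le]
    nth_rw 2 [← Real.rpow_one ε]
    rw [← Real.rpow_add hε]
    congr 1
    rw [he]; field_simp; ring
  obtain ⟨F₁, hF₁c, hF₁I, hF₁⟩ := exists_finset_net (Set.Icc 1 (R ^ 2)) (fun t => √t) hε
    hR0.le (fun t ht => ⟨Real.sqrt_nonneg t, hsq ▸ Real.sqrt_le_sqrt ht.2⟩)
  obtain ⟨F₂, hF₂c, hF₂I, hF₂⟩ := exists_finset_net (Set.Ici (R ^ 2)) (fun t => t ^ (-β)) hε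
    (L := ε * R ^ 2) (by positivity) (fun t ht => ⟨by
      have : 0 ≤ t := by linarith [Set.mem_Ici.1 ht]
      positivity, by
      rw [← hTβ]
      exact Real.rpow_le_rpow_of_nonpos (by positivity) ht (by linarith)⟩)
  -- Beyond `T` the radius is at most `C/R`, so angular mesh `ε R` moves a point by at most `C ε`.
  obtain ⟨F₃, hF₃c, -, hF₃⟩ := exists_finset_net (Set.Icc 0 (2 * Real.pi)) (fun t => t)
    (ε := ε * R) (L := 2 * Real.pi) (by positivity) (by positivity) (fun t ht => ht)
  have hprof : ∀ (f : ℝ → ℝ), (∀ s t, 1 ≤ s → s ≤ t → |f s - f t| ≤ C * (s ^ (-β) - t ^ (-β))) →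
      ∀ s t, 1 ≤ s → 1 ≤ t → |f s - f t| ≤ C * |s ^ (-β) - t ^ (-β)| := by
    intro f hf s t hs ht
    rcases le_total s t with h | h
    · exact (hf s t hs h).trans (by gcongr; exact le_abs_self _)
    · rw [abs_sub_comm, abs_sub_comm (s ^ (-β))]
      exact (hf t s ht h).trans (by gcongr; exact le_abs_self _)
  -- Used on the strand before `T`. The profile contributes `C ε` in each of `r` and `z`; rotation
  -- contributes `2 C ε`, because `t - s = (√t - √s)(√t + √s)` and the radius at `t` is at most
  -- `C/√t`.
  have htail : ∀ s t, 1 ≤ s → s ≤ t → √t - √s ≤ ε →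
      dist (cylPoint (r s) (φ s) (z s)) (cylPoint (r t) (φ t) (z t)) ≤ 4 * C * ε := by
    intro s t hs hst h
    have ht : 1 ≤ t := hs.trans hst
    have hd := rpow_neg_sub_rpow_neg_le_sqrt_sub hβ.le hβ' hs hst
    have h1 : |r s - r t| ≤ C * ε := (hdr s t hs hst).trans (by gcongr; linarith)
    have h2 : |z s - z t| ≤ C * ε := (hdz s t hs hst).trans (by gcongr; linarith)
    have hss : √s ≤ √t := Real.sqrt_le_sqrt hst
    have ht1 : 1 ≤ √t := Real.one_le_sqrt.2 ht
    have h3 : |r t| * |φ s - φ t| ≤ 2 * C * ε := by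
      calc |r t| * |φ s - φ t| ≤ C / √t * |s - t| := by
            exact mul_le_mul (hr t ht) (hφ s t hs ht) (abs_nonneg _) (by positivity)
        _ = C / √t * ((√t - √s) * (√t + √s)) := by
            rw [abs_sub_comm, abs_of_nonneg (by linarith)]
            congr 1
            nlinarith [Real.mul_self_sqrt (by linarith : 0 ≤ s),
              Real.mul_self_sqrt (by linarith : 0 ≤ t)]
        _ ≤ C / √t * (ε * (2 * √t)) := by
            gcongr
            linarith
        _ = 2 * C * ε := by field_simp
    linarith [dist_cylPoint_le (r s) (φ s) (z s) (r t) (φ t) (z t)]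
  -- The second family samples the whole surface of revolution, with angles independent of `φ`, so
  -- its points need not lie on the curve.
  have hcard : ((F₁.image (fun s => cylPoint (r s) (φ s) (z s)) ∪
      (F₂ ×ˢ F₃).image (fun q => cylPoint (r q.1) q.2 (z q.1))).card : ℝ) ≤ 18 * R / ε := by
    have c1 : (F₁.image (fun s => cylPoint (r s) (φ s) (z s)) ∪
      (F₂ ×ˢ F₃).image (fun q => cylPoint (r q.1) q.2 (z q.1))).card ≤
        F₁.card + F₂.card * F₃.card := by
      refine (Finset.card_union_le _ _).trans (add_le_add Finset.card_image_le ?_)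
      exact Finset.card_image_le.trans (Finset.card_product _ _).le
    have c2 : ((F₁.image (fun s => cylPoint (r s) (φ s) (z s)) ∪
      (F₂ ×ˢ F₃).image (fun q => cylPoint (r q.1) q.2 (z q.1))).card : ℝ) ≤
        F₁.card + F₂.card * F₃.card := by exact_mod_cast c1
    have hεR : ε * R ≤ 1 := by
      have : ε * R ^ 2 ≤ 1 := by
        rw [← hTβ]; exact Real.rpow_le_one_of_one_le_of_nonpos hT1 (by linarith)
      nlinarith
    have d1 : (F₁.card : ℝ) ≤ 2 * R / ε := by
      have : 1 ≤ R / ε := (one_le_div hε).2 (by linarith)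
      rw [mul_div_assoc]; linarith
    have d2 : (F₂.card : ℝ) ≤ 2 * R ^ 2 := by
      rw [mul_div_cancel_left₀ _ hε.ne'] at hF₂c; linarith
    have d3 : (F₃.card : ℝ) ≤ 8 / (ε * R) := by
      have : 1 ≤ 1 / (ε * R) := (one_le_div (by positivity)).2 hεR
      have h7 : 2 * Real.pi / (ε * R) ≤ 7 / (ε * R) := by
        gcongr; linarith [Real.pi_lt_d2]
      have : 8 / (ε * R) = 7 / (ε * R) + 1 / (ε * R) := by ring
      linarith
    calc _ ≤ _ := c2
      _ ≤ 2 * R / ε + 2 * R ^ 2 * (8 / (ε * R)) := by gcongr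
      _ = 18 * R / ε := by field_simp; norm_num
  refine (volume_thickening_le_of_net _ hε (K := 4 * C) (by positivity) hcard ?_).trans ?_
  · rintro _ ⟨t, ht, rfl⟩
    have ht : 1 ≤ t := ht
    rcases le_total t (R ^ 2) with h | h
    · obtain ⟨s, hs, hts⟩ := hF₁ t ⟨ht, h⟩
      refine ⟨_, Finset.mem_union_left _ (Finset.mem_image_of_mem _ hs), ?_⟩
      have hs1 := (hF₁I s hs).1
      rcases le_total s t with hst | hst
      · rw [dist_comm]
        exact htail s t hs1 hst ((le_abs_self _).trans hts)
      · exact htail t s ht hst ((le_abs_self _).trans (by rwa [abs_sub_comm]))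
    · obtain ⟨s, hs, hts⟩ := hF₂ t h
      obtain ⟨ψ, hψ, hψe⟩ := exists_mem_Icc_cylPoint_eq (r t) (φ t) (z t)
      obtain ⟨ψ', hψ', hψψ⟩ := hF₃ ψ hψ
      refine ⟨_, Finset.mem_union_right _ (Finset.mem_image_of_mem _
        (Finset.mk_mem_product hs hψ')), ?_⟩
      have hs2 : R ^ 2 ≤ s := hF₂I s hs
      have hs1 : 1 ≤ s := hT1.trans hs2
      have h1 : |r t - r s| ≤ C * ε := (hprof r hdr t s ht hs1).trans (by gcongr)
      have h2 : |z t - z s| ≤ C * ε := (hprof z hdz t s ht hs1).trans (by gcongr)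
      have h3 : |r s| * |ψ - ψ'| ≤ C * ε := by
        have : R ≤ √s := hsq ▸ Real.sqrt_le_sqrt hs2
        calc |r s| * |ψ - ψ'| ≤ C / R * (ε * R) := by
              gcongr
              exact (hr s hs1).trans (by gcongr)
          _ = C * ε := by field_simp
      simp only [hψe]
      have := dist_cylPoint_le (r t) ψ (z t) (r s) ψ' (z s)
      nlinarith [mul_pos hC hε]
  · rw [← hv, ← ENNReal.ofReal_toReal hvtop, ← ENNReal.ofReal_mul (by positivity),
      ENNReal.toReal_ofReal ENNReal.toReal_nonneg]
    apply ENNReal.ofReal_le_ofReal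
    have : ε ^ (2 - e) = ε ^ 2 * R := by
      rw [sub_eq_add_neg, Real.rpow_add hε]; norm_num [hR]
    rw [this]
    apply le_of_eq
    field_simp

/-! ### Lower volume bound for a spiral -/

theorem half_le_natFloor {x : ℝ} (hx : 1 ≤ x) : x / 2 ≤ (⌊x⌋₊ : ℝ) := by
  have h1 := Nat.lt_floor_add_one x
  have h2 : (1 : ℝ) ≤ ⌊x⌋₊ := by exact_mod_cast Nat.one_le_floor_iff x |>.2 hx
  linarith

/-- Lower bound for the volume of the neighbourhoods of a spiral of radius at least
`c * s ^ (-1/2)` whose consecutive windings are separated. -/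
theorem le_volume_thickening_spiral {r φ z : ℝ → ℝ} {β c S φ₀ τ : ℝ} (hβ : 0 < β)
    (hβ' : β ≤ 1 / 2) (hc : 0 < c) (hτ : |τ| = 1)
    (hr : ∀ s, S ≤ s → c / √s ≤ r s)
    (hsep : ∀ s t, S ≤ s → s ≤ t → c * (t - s) * t ^ (-1 - β) ≤ |r s - r t| + |z s - z t|)
    (hφ : ∀ s, 1 ≤ s → φ s = φ₀ + τ * s) :
    ∃ c' : ℝ, 0 < c' ∧ ∀ᶠ ε : ℝ in 𝓝[>] 0, ENNReal.ofReal (c' * ε ^ (2 - 1 / (2 * (1 + β)))) ≤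
      volume (Metric.thickening ε ((fun s => cylPoint (r s) (φ s) (z s)) '' Set.Ici 1)) := by
  set v := volume (Metric.ball (0 : EuclideanSpace ℝ (Fin 3)) 1) with hv
  have hvtop : v ≠ ⊤ := measure_ball_lt_top.ne
  have hvpos : 0 < v.toReal := ENNReal.toReal_pos (Metric.measure_ball_pos _ _ one_pos).ne' hvtop
  set e := 1 / (2 * (1 + β)) with he
  have he0 : 0 < e := by positivity
  -- Chosen so that windings at least `6` apart in parameter have `|Δr| + |Δz| ≥ 6 c (ε/κ)/27 = 4
  -- ε`. The factor `27 = 9 ^ (3/2)` is the loss in `t ^ (-1-β)` between `R ^ 2` and `9 R ^ 2`.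
  set κ := c / 18 with hκ
  have hκ0 : 0 < κ := by positivity
  refine ⟨c / 48 * κ ^ e * v.toReal, by positivity, ?_⟩
  have hlim : Tendsto (fun ε : ℝ => (ε / κ) ^ (-e)) (𝓝[>] 0) atTop := by
    have h1 : Tendsto (fun ε : ℝ => ε / κ) (𝓝[>] 0) (𝓝[>] 0) := by
      refine tendsto_nhdsWithin_iff.2 ⟨?_, ?_⟩
      · have : Tendsto (fun ε : ℝ => ε / κ) (𝓝 0) (𝓝 (0 / κ)) := tendsto_id.div_const κ
        rw [zero_div] at this
        exact this.mono_left nhdsWithin_le_nhds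
      · filter_upwards [self_mem_nhdsWithin] with ε hε
        exact div_pos hε hκ0
    exact (tendsto_rpow_neg_nhdsGT_zero (by linarith)).comp h1
  filter_upwards [self_mem_nhdsWithin, hlim.eventually_ge_atTop 2, hlim.eventually_ge_atTop S]
    with ε hε hR2 hRS
  have hε : 0 < ε := hε
  set R := (ε / κ) ^ (-e) with hR
  have hR0 : 0 < R := by linarith
  have hεκ : 0 < ε / κ := by positivity
  have hTβ : (R ^ 2) ^ (-1 - β) = ε / κ := by
    have hRR : R ^ 2 = (ε / κ) ^ (-e * 2) := by
      rw [hR, ← Real.rpow_natCast, ← Real.rpow_mul hεκ.le]; norm_num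
    rw [hRR, ← Real.rpow_mul hεκ.le]
    nth_rw 2 [← Real.rpow_one (ε / κ)]
    congr 1
    rw [he]; field_simp; ring
  have hT1 : 4 ≤ R ^ 2 := by nlinarith
  have hTS : S ≤ R ^ 2 := by nlinarith
  -- Angular step: at radius at least `c/(3R)`, a sine of at least `θ/2` separates points by `2 ε`.
  set θ := 12 * ε * R / c with hθ
  have hθ0 : 0 < θ := by positivity
  have hθ1 : θ ≤ 1 := by
    have h1 : (R ^ 2) ^ (-1 - β) ≤ (R ^ 2) ^ (-1 : ℝ) :=
      Real.rpow_le_rpow_of_exponent_le (by linarith) (by linarith)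
    rw [hTβ, Real.rpow_neg_one, ← one_div, div_le_div_iff₀ hκ0 (by positivity), hκ] at h1
    rw [hθ, div_le_one hc]
    nlinarith [mul_pos hε hR0]
  set K := ⌊R ^ 2⌋₊
  set M := ⌊1 / θ⌋₊
  have hK : (K : ℝ) ≤ R ^ 2 := Nat.floor_le (by positivity)
  have hM : (M : ℝ) * θ ≤ 1 := by
    have := Nat.floor_le (by positivity : 0 ≤ 1 / θ)
    rwa [le_div_iff₀ hθ0] at this
  -- `q.1` counts full turns and `q.2` the angular steps within a turn. As `M θ ≤ 1`, the steps span
  -- at most one radian, where the sine is comparable to the angle.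
  let s : ℕ × ℕ → ℝ := fun q => R ^ 2 + 2 * Real.pi * q.1 + q.2 * θ
  have hs_low : ∀ q, R ^ 2 ≤ s q := by
    intro q
    have h1 : 0 ≤ 2 * Real.pi * q.1 := by positivity
    have h2 : 0 ≤ q.2 * θ := by positivity
    simp only [s]; linarith
  have hs_up : ∀ q ∈ Finset.range K ×ˢ Finset.range M, s q ≤ 9 * R ^ 2 := by
    intro q hq
    obtain ⟨h1, h2⟩ := Finset.mem_product.1 hq
    have h1' : (q.1 : ℝ) ≤ K := by exact_mod_cast (Finset.mem_range.1 h1).le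
    have h2' : (q.2 : ℝ) ≤ M := by exact_mod_cast (Finset.mem_range.1 h2).le
    have h3 : 2 * Real.pi * q.1 ≤ 6.3 * R ^ 2 := by
      have := Real.pi_lt_d2
      gcongr
      · linarith
      · linarith
    have h4 : q.2 * θ ≤ 1 := le_trans (by gcongr) hM
    simp only [s]; linarith
  have hφd : ∀ q q', φ (s q) - φ (s q') =
      τ * ((q.2 - q'.2) * θ) + τ * (((q.1 : ℤ) - (q'.1 : ℤ) : ℤ) : ℝ) * (2 * Real.pi) := by
    intro q q'
    rw [hφ _ (by linarith [hs_low q]), hφ _ (by linarith [hs_low q'])]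
    push_cast
    simp only [s]; ring
  have hτ' : τ = 1 ∨ τ = -1 := eq_or_eq_neg_of_abs_eq hτ
  have hcount : c * R / (48 * ε) ≤ ((Finset.range K ×ˢ Finset.range M).card : ℝ) := by
    rw [Finset.card_product, Finset.card_range, Finset.card_range, Nat.cast_mul]
    have k1 : R ^ 2 / 2 ≤ K := half_le_natFloor (by linarith)
    have k2 : 1 / θ / 2 ≤ M := half_le_natFloor ((one_le_div hθ0).2 hθ1)
    calc c * R / (48 * ε) = R ^ 2 / 2 * (1 / θ / 2) := by rw [hθ]; field_simp; norm_num
      _ ≤ _ := by gcongr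
  refine le_trans ?_ (le_volume_thickening_of_separated (Finset.range K ×ˢ Finset.range M)
    (fun q => cylPoint (r (s q)) (φ (s q)) (z (s q))) hε hcount ?_ ?_)
  · rw [← hv, ← ENNReal.ofReal_toReal hvtop, ← ENNReal.ofReal_mul (by positivity),
      ENNReal.toReal_ofReal ENNReal.toReal_nonneg]
    apply ENNReal.ofReal_le_ofReal
    have h1 : ε ^ (2 - e) * κ ^ e = ε ^ 2 * R := by
      rw [sub_eq_add_neg, Real.rpow_add hε, hR, Real.div_rpow hε.le hκ0.le,
        Real.rpow_neg hκ0.le e]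
      norm_num [mul_assoc]
    apply le_of_eq
    calc _ = c / 48 * (ε ^ (2 - e) * κ ^ e) * v.toReal := by ring
      _ = _ := by rw [h1]; field_simp
  · intro q _
    exact ⟨s q, by have := hs_low q; exact Set.mem_Ici.2 (by linarith), rfl⟩
  · intro q hq q' hq' hne
    -- Points at the same angle on different windings are separated by the profile; points at
    -- different angles by rotation, whatever their windings.
    by_cases h2 : q.2 = q'.2
    · have hcos : ∀ q q' : ℕ × ℕ, q.2 = q'.2 → q.1 < q'.1 → q' ∈ Finset.range K ×ˢ Finset.range M →
          2 * ε ≤ dist (cylPoint (r (s q)) (φ (s q)) (z (s q)))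
            (cylPoint (r (s q')) (φ (s q')) (z (s q'))) := by
        intro q q' h2 h1 hq'
        have hd : s q' - s q = 2 * Real.pi * (q'.1 - q.1) := by simp only [s, h2]; ring
        have h1' : (q.1 : ℝ) + 1 ≤ q'.1 := by exact_mod_cast h1
        have hd6 : 6 ≤ s q' - s q := by
          rw [hd]; nlinarith [Real.pi_gt_three]
        have hang : ∃ m : ℤ, φ (s q) = φ (s q') + m * (2 * Real.pi) := by
          have := hφd q q'
          rw [h2, sub_self, zero_mul, mul_zero, zero_add] at this
          rcases hτ' with h | h
          · exact ⟨(q.1 : ℤ) - (q'.1 : ℤ), by rw [h] at this; linarith⟩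
          · refine ⟨-((q.1 : ℤ) - (q'.1 : ℤ)), ?_⟩
            rw [h] at this
            rw [Int.cast_neg]; linarith
        obtain ⟨m, hm⟩ := hang
        have hdist := le_dist_cylPoint_of_same_angle (r₁ := r (s q)) (z₁ := z (s q))
          (r₂ := r (s q')) (z₂ := z (s q')) (φ₁ := φ (s q)) (φ₂ := φ (s q'))
          (by rw [hm, Real.cos_add_int_mul_two_pi]) (by rw [hm, Real.sin_add_int_mul_two_pi])
        have hse := hsep (s q) (s q') (by linarith [hs_low q]) (by linarith)
        have hpow : ε / κ / 27 ≤ (s q') ^ (-1 - β) := by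
          calc ε / κ / 27 = (R ^ 2) ^ (-1 - β) * (1 / 27) := by rw [hTβ]; ring
            _ ≤ (R ^ 2) ^ (-1 - β) * 9 ^ (-1 - β) := by
                gcongr
                calc (1 / 27 : ℝ) = 9 ^ (-(3 / 2) : ℝ) := by
                      rw [show (9 : ℝ) = 3 ^ (2 : ℝ) by norm_num, ← Real.rpow_mul (by norm_num),
                        show (2 : ℝ) * -(3 / 2) = -(3 : ℕ) by norm_num, Real.rpow_neg (by norm_num),
                        Real.rpow_natCast]
                      norm_num
                  _ ≤ _ := Real.rpow_le_rpow_of_exponent_le (by norm_num) (by linarith)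
            _ = (R ^ 2 * 9) ^ (-1 - β) := by rw [Real.mul_rpow (by positivity) (by norm_num)]
            _ ≤ _ := Real.rpow_le_rpow_of_nonpos (by linarith [hs_low q'])
                  (by linarith [hs_up q' hq']) (by linarith)
        have : c * 6 * (ε / κ / 27) ≤ c * (s q' - s q) * (s q') ^ (-1 - β) := by gcongr
        have h4 : c * 6 * (ε / κ / 27) = 4 * ε := by rw [hκ]; field_simp; norm_num
        linarith
      rcases lt_trichotomy q.1 q'.1 with h | h | h
      · exact hcos q q' h2 h hq'
      · exact absurd (Prod.ext h h2) hne
      · rw [dist_comm]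
        exact hcos q' q h2.symm h hq
    · have hsin : θ / 2 ≤ |Real.sin (φ (s q) - φ (s q'))| := by
        have hx : |(q.2 : ℝ) - q'.2| * θ ≤ 1 := by
          have b1 : (q.2 : ℝ) ≤ M := by
            exact_mod_cast (Finset.mem_range.1 (Finset.mem_product.1 hq).2).le
          have b2 : (q'.2 : ℝ) ≤ M := by
            exact_mod_cast (Finset.mem_range.1 (Finset.mem_product.1 hq').2).le
          have b3 : (0 : ℝ) ≤ q.2 := by positivity
          have b4 : (0 : ℝ) ≤ q'.2 := by positivity
          have : |(q.2 : ℝ) - q'.2| ≤ M := by rw [abs_le]; constructor <;> linarith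
          exact le_trans (by gcongr) hM
        have habs : |Real.sin (φ (s q) - φ (s q'))| = Real.sin (|(q.2 : ℝ) - q'.2| * θ) := by
          have hsn : 0 ≤ Real.sin (|(q.2 : ℝ) - q'.2| * θ) :=
            Real.sin_nonneg_of_nonneg_of_le_pi (by positivity) (by linarith [Real.pi_gt_three])
          have e1 : |Real.sin (φ (s q) - φ (s q'))| = |Real.sin (((q.2 : ℝ) - q'.2) * θ)| := by
            rw [hφd]
            rcases hτ' with h | h
            · rw [h, one_mul, one_mul, Real.sin_add_int_mul_two_pi]
            · rw [h, ← abs_neg, ← Real.sin_neg]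
              rw [show -(-1 * (((q.2 : ℝ) - q'.2) * θ) +
                -1 * (((q.1 : ℤ) - (q'.1 : ℤ) : ℤ) : ℝ) * (2 * Real.pi)) =
                ((q.2 : ℝ) - q'.2) * θ + (((q.1 : ℤ) - (q'.1 : ℤ) : ℤ) : ℝ) * (2 * Real.pi) by ring,
                Real.sin_add_int_mul_two_pi]
          rw [e1]
          rcases abs_cases ((q.2 : ℝ) - q'.2) with ⟨h, _⟩ | ⟨h, _⟩
          · rw [h] at hsn ⊢; exact abs_of_nonneg hsn
          · rw [h] at hsn ⊢
            rw [neg_mul, Real.sin_neg] at hsn ⊢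
            rw [abs_of_nonpos (by linarith)]
        rw [habs]
        have hge : 1 ≤ |(q.2 : ℝ) - q'.2| := by
          have : (1 : ℤ) ≤ |(q.2 : ℤ) - q'.2| := Int.one_le_abs (by omega)
          exact_mod_cast this
        have hml := Real.mul_le_sin (by positivity : 0 ≤ |(q.2 : ℝ) - q'.2| * θ)
          (by linarith [Real.pi_gt_three])
        have h2pi : 1 / 2 ≤ 2 / Real.pi := by
          rw [div_le_div_iff₀ (by norm_num) Real.pi_pos]; linarith [Real.pi_lt_d2]
        have : 1 / 2 * (1 * θ) ≤ 2 / Real.pi * (|(q.2 : ℝ) - q'.2| * θ) := by gcongr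
        linarith
      have hrad : c / (3 * R) ≤ |r (s q)| := by
        have h3R : √(9 * R ^ 2) = 3 * R := by
          rw [show 9 * R ^ 2 = (3 * R) ^ 2 by ring, Real.sqrt_sq (by positivity)]
        calc c / (3 * R) ≤ c / √(s q) := by
              have hpos : 0 < √(s q) := Real.sqrt_pos.2 (by linarith [hs_low q])
              gcongr
              rw [← h3R]; exact Real.sqrt_le_sqrt (hs_up q hq)
          _ ≤ r (s q) := hr _ (by linarith [hs_low q])
          _ ≤ _ := le_abs_self _
      calc 2 * ε = c / (3 * R) * (θ / 2) := by rw [hθ]; field_simp; norm_num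
        _ ≤ |r (s q)| * |Real.sin (φ (s q) - φ (s q'))| := by gcongr
        _ ≤ _ := abs_mul_sin_le_dist_cylPoint _ _ _ _ _ _

/-! ### Decay rates for scalar equations -/

/-- Comparison of increments from comparison of derivatives. -/
theorem abs_sub_le_mul_of_abs_deriv_le {f g f' g' : ℝ → ℝ} {a b C : ℝ} (hab : a ≤ b)
    (hf : ContinuousOn f (Set.Icc a b)) (hg : ContinuousOn g (Set.Icc a b))
    (hf' : ∀ x ∈ Set.Ioo a b, HasDerivAt f (f' x) x)
    (hg' : ∀ x ∈ Set.Ioo a b, HasDerivAt g (g' x) x) (hne : ∀ x ∈ Set.Ioo a b, g' x ≠ 0)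
    (hle : ∀ x ∈ Set.Ioo a b, |f' x| ≤ C * |g' x|) : |f a - f b| ≤ C * |g a - g b| := by
  rcases hab.eq_or_lt with rfl | hab
  · simp
  obtain ⟨x, hx, h⟩ := exists_ratio_hasDerivAt_eq_ratio_slope f f' hab hf hf' g g' hg hg'
  have h1 : |g b - g a| * |f' x| = |f b - f a| * |g' x| := by rw [← abs_mul, ← abs_mul, h]
  have h2 : 0 < |g' x| := abs_pos.2 (hne x hx)
  rw [abs_sub_comm, abs_sub_comm (g a)]
  refine le_of_mul_le_mul_right ?_ h2
  rw [← h1]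
  nlinarith [mul_le_mul_of_nonneg_left (hle x hx) (abs_nonneg (g b - g a))]

/-- A nonvanishing solution of `w' = w ^ p * H`, `H → B ≠ 0`, decays like `s ^ (-1 / (p - 1))`. -/
theorem abs_asymptotics_of_deriv_eq_pow_mul {w H : ℝ → ℝ} {p : ℕ} {B : ℝ} (hp : 2 ≤ p)
    (hB : B ≠ 0) (hw : ∀ᶠ s in atTop, w s ≠ 0)
    (hd : ∀ᶠ s in atTop, HasDerivAt w (w s ^ p * H s) s) (hH : Tendsto H atTop (𝓝 B)) :
    ∃ c C : ℝ, 0 < c ∧ 0 < C ∧ ∀ᶠ s in atTop,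
      c * s ^ (-(((p : ℝ) - 1)⁻¹)) ≤ |w s| ∧ |w s| ≤ C * s ^ (-(((p : ℝ) - 1)⁻¹)) ∧
      c * s ^ (-1 - ((p : ℝ) - 1)⁻¹) ≤ |w s ^ p * H s| ∧
      |w s ^ p * H s| ≤ C * s ^ (-1 - ((p : ℝ) - 1)⁻¹) := by
  obtain ⟨m, rfl⟩ : ∃ m, p = m + 2 := ⟨p - 2, by omega⟩
  have hB0 : 0 < |B| := abs_pos.2 hB
  have hHb : ∀ᶠ s in atTop, |B| / 2 ≤ |H s| ∧ |H s| ≤ 2 * |B| := by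
    have := hH.abs
    filter_upwards [this.eventually (eventually_ge_nhds (by linarith : |B| / 2 < |B|)),
      this.eventually (eventually_le_nhds (by linarith : |B| < 2 * |B|))] with s h1 h2
    exact ⟨h1, h2⟩
  obtain ⟨S₀, hS₀⟩ := eventually_atTop.1 (hw.and (hd.and hHb))
  set S := max S₀ 1
  have hS1 : 1 ≤ S := le_max_right _ _
  have hS : ∀ s, S ≤ s → w s ≠ 0 ∧ HasDerivAt w (w s ^ (m + 2) * H s) s ∧
      |B| / 2 ≤ |H s| ∧ |H s| ≤ 2 * |B| := fun s hs => hS₀ s ((le_max_left _ _).trans hs)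
  set q : ℝ := m + 1 with hq
  have hq0 : 0 < q := by positivity
  have hpq : (((m + 2 : ℕ) : ℝ) - 1) = q := by rw [hq]; push_cast; ring
  rw [hpq]
  -- The substitution `u = w ^ (-(p-1))` gives `u' = -(p-1) H`, so `|u|` grows linearly and the
  -- rates of `w` and `w'` are powers of `|u|`.
  set u : ℝ → ℝ := fun s => (w s ^ (m + 1))⁻¹ with hu
  have hud : ∀ s, S ≤ s → HasDerivAt u (-(q * H s)) s := by
    intro s hs
    obtain ⟨h0, h1, -⟩ := hS s hs
    have := (h1.pow (m + 1)).inv (pow_ne_zero _ h0)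
    refine HasDerivAt.congr_deriv this ?_
    rw [hq, Pi.pow_apply, Nat.add_sub_cancel]
    push_cast
    field_simp
    ring
  have hmvt : ∀ s, S < s → q * (|B| / 2) * (s - S) ≤ |u s - u S| ∧
      |u s - u S| ≤ q * (2 * |B|) * (s - S) := by
    intro s hs
    obtain ⟨x, hx, h⟩ := exists_hasDerivAt_eq_slope u (fun s => -(q * H s)) hs
      (fun y hy => (hud y hy.1).continuousAt.continuousWithinAt) (fun y hy => hud y hy.1.le)
    have hsS : 0 < s - S := by linarith
    have h2 : |u s - u S| = q * |H x| * (s - S) := by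
      rw [eq_div_iff hsS.ne'] at h
      rw [← h, abs_mul, abs_neg, abs_mul, abs_of_pos hq0, abs_of_pos hsS]
    obtain ⟨-, -, h3, h4⟩ := hS x hx.1.le
    rw [h2]
    constructor <;> gcongr
  set k := q * (|B| / 2) with hk
  have hk0 : 0 < k := by positivity
  set a := k / 2
  set A := |u S| + q * (2 * |B|)
  have ha0 : 0 < a := by positivity
  have hA0 : 0 < A := by positivity
  have hub : ∀ᶠ s in atTop, a * s ≤ |u s| ∧ |u s| ≤ A * s := by
    filter_upwards [eventually_gt_atTop S, eventually_ge_atTop (2 * (S + |u S| / k))] with s h1 h2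
    obtain ⟨h3, h4⟩ := hmvt s h1
    constructor
    · have h5 : |u s - u S| ≤ |u s| + |u S| := abs_sub _ _
      have h6 : k * (2 * (S + |u S| / k)) ≤ k * s := by gcongr
      have h7 : k * (2 * (S + |u S| / k)) = 2 * (k * S) + 2 * |u S| := by field_simp
      have h8 : a * s = k * s / 2 := by simp only [a]; ring
      nlinarith
    · have h5 : |u s| ≤ |u s - u S| + |u S| := by
        have := abs_add_le (u s - u S) (u S)
        simpa using this
      have h6 : |u S| ≤ |u S| * s := le_mul_of_one_le_right (abs_nonneg _) (by linarith)
      have h7 : q * (2 * |B|) * (s - S) ≤ q * (2 * |B|) * s := by gcongr; linarith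
      have h8 : A * s = |u S| * s + q * (2 * |B|) * s := by simp only [A]; ring
      linarith
  set c₁ := A ^ (-q⁻¹)
  set C₁ := a ^ (-q⁻¹)
  set c₂ := A ^ (-1 - q⁻¹) * (|B| / 2)
  set C₂ := a ^ (-1 - q⁻¹) * (2 * |B|)
  have hc₁ : 0 < c₁ := by positivity
  have hC₁ : 0 < C₁ := by positivity
  have hc₂ : 0 < c₂ := by positivity
  refine ⟨min c₁ c₂, max C₁ C₂, lt_min hc₁ hc₂, lt_max_of_lt_left hC₁, ?_⟩
  filter_upwards [hub, eventually_ge_atTop S] with s ⟨hu1, hu2⟩ hsS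
  have hs0 : 0 < s := by linarith
  obtain ⟨hw0, -, hH1, hH2⟩ := hS s hsS
  have hu0 : 0 < |u s| := lt_of_lt_of_le (by positivity) hu1
  have hwq : |w s| = |u s| ^ (-q⁻¹) := by
    have e : |u s| = (|w s| ^ (m + 1))⁻¹ := by rw [hu]; simp only [abs_inv, abs_pow]
    rw [e, Real.rpow_neg (by positivity), Real.inv_rpow (by positivity), inv_inv,
      show q = ((m + 1 : ℕ) : ℝ) by rw [hq]; push_cast; ring]
    exact (Real.pow_rpow_inv_natCast (abs_nonneg _) (by omega)).symm
  have hwp : |w s ^ (m + 2) * H s| = |u s| ^ (-1 - q⁻¹) * |H s| := by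
    rw [abs_mul]
    congr 1
    rw [sub_eq_add_neg, Real.rpow_add hu0, ← hwq, Real.rpow_neg_one]
    have e : |u s|⁻¹ = |w s| ^ (m + 1) := by rw [hu]; simp only [abs_inv, abs_pow, inv_inv]
    rw [e, abs_pow, pow_succ]
  have hneg : -q⁻¹ ≤ 0 := by have := inv_pos.2 hq0; linarith
  have hneg' : -1 - q⁻¹ ≤ 0 := by linarith
  have lo : ∀ x : ℝ, x ≤ 0 → A ^ x * s ^ x ≤ |u s| ^ x := fun x hx => by
    rw [← Real.mul_rpow hA0.le hs0.le]
    exact Real.rpow_le_rpow_of_nonpos hu0 hu2 hx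
  have hi : ∀ x : ℝ, x ≤ 0 → |u s| ^ x ≤ a ^ x * s ^ x := fun x hx => by
    rw [← Real.mul_rpow ha0.le hs0.le]
    exact Real.rpow_le_rpow_of_nonpos (by positivity) hu1 hx
  rw [hwp, hwq]
  refine ⟨?_, ?_, ?_, ?_⟩
  · exact le_trans (by gcongr; exact min_le_left _ _) (lo _ hneg)
  · exact (hi _ hneg).trans (by gcongr; exact le_max_left _ _)
  · calc _ ≤ c₂ * s ^ (-1 - q⁻¹) := by gcongr; exact min_le_right _ _
      _ = A ^ (-1 - q⁻¹) * s ^ (-1 - q⁻¹) * (|B| / 2) := by simp only [c₂]; ring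
      _ ≤ _ := by
        have := lo _ hneg'
        gcongr
  · calc _ ≤ a ^ (-1 - q⁻¹) * s ^ (-1 - q⁻¹) * (2 * |B|) := by
          have := hi _ hneg'
          gcongr
      _ = C₂ * s ^ (-1 - q⁻¹) := by simp only [C₂]; ring
      _ ≤ _ := by gcongr; exact le_max_right _ _

/-- A solution of a linear scalar equation that is nonzero at one time is nonzero later. -/
theorem ne_zero_of_deriv_eq_mul {z q : ℝ → ℝ} {a b : ℝ} (hab : a ≤ b)
    (hz : ContinuousOn z (Set.Icc a b)) (hq : ContinuousOn q (Set.Icc a b))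
    (hd : ∀ s ∈ Set.Ioc a b, HasDerivAt z (z s * q s) s) (ha : z a ≠ 0) : z b ≠ 0 := by
  intro hb
  obtain ⟨K, hK⟩ := isCompact_Icc.exists_bound_of_continuousOn hq
  have hmaps : Set.MapsTo (fun s : ℝ => b - s) (Set.Icc 0 (b - a)) (Set.Icc a b) := by
    intro s hs; constructor <;> linarith [hs.1, hs.2]
  -- Grönwall backwards in time: a zero at `b` would propagate to `a`.
  have := norm_le_gronwallBound_of_norm_deriv_right_le (f := fun s => z (b - s))
    (f' := fun s => -(z (b - s) * q (b - s))) (δ := 0) (K := K) (ε := 0) (a := 0) (b := b - a)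
    (hz.comp (by fun_prop) hmaps) (fun s hs => ?_) (by simp [hb]) (fun s hs => ?_) (b - a)
    ⟨by linarith, le_rfl⟩
  · rw [gronwallBound_ε0_δ0] at this
    simp at this
    exact ha this
  · have h1 := hd (b - s) ⟨by linarith [hs.2], by linarith [hs.1]⟩
    have h2 : HasDerivAt (fun s : ℝ => b - s) (-1) s := by
      simpa using (hasDerivAt_id s).const_sub b
    have h3 := h1.comp s h2
    simp only [mul_neg, mul_one] at h3
    exact h3.hasDerivWithinAt
  · have h1 := hK (b - s) ⟨by linarith [hs.2], by linarith [hs.1]⟩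
    simp only [norm_neg, norm_mul, add_zero]
    rw [mul_comm]
    gcongr

/-- The decay rates hold only for large `s`, while the covering argument starts at `s = 1`; on the
remaining compact interval the ratio is continuous, hence bounded. -/
theorem exists_bound_of_eventually_bound {F g : ℝ → ℝ} {a C : ℝ} (hF : ContinuousOn F (Set.Ici a))
    (hg : ContinuousOn g (Set.Ici a)) (hg0 : ∀ s, a ≤ s → 0 < g s)
    (h : ∀ᶠ s in atTop, |F s| ≤ C * g s) :
    ∃ C' : ℝ, 0 < C' ∧ ∀ s, a ≤ s → |F s| ≤ C' * g s := by
  obtain ⟨S, hS⟩ := eventually_atTop.1 h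
  have hc : ContinuousOn (fun s => F s / g s) (Set.Icc a S) :=
    (hF.mono Set.Icc_subset_Ici_self).div (hg.mono Set.Icc_subset_Ici_self)
      fun s hs => (hg0 s hs.1).ne'
  obtain ⟨K, hK⟩ := isCompact_Icc.exists_bound_of_continuousOn hc
  refine ⟨max 1 (max C K), lt_max_of_lt_left one_pos, fun s hs => ?_⟩
  have hgs := hg0 s hs
  rcases le_total S s with h1 | h1
  · exact (hS s h1).trans (by gcongr; exact (le_max_left _ _).trans (le_max_right _ _))
  · have := hK s ⟨hs, h1⟩
    rw [Real.norm_eq_abs, abs_div, abs_of_pos hgs, div_le_iff₀ hgs] at this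
    exact this.trans (by gcongr; exact (le_max_right _ _).trans (le_max_right _ _))

/-- Cauchy's mean value theorem against `x ^ (-β)`, whose derivative `-β x ^ (-β-1)` produces the
factor `1/β`. -/
theorem abs_sub_le_rpow_neg_sub {f f' : ℝ → ℝ} {β C s t : ℝ} (hβ : 0 < β) (hs : 1 ≤ s)
    (hst : s ≤ t)
    (hf : ∀ x, 1 ≤ x → HasDerivWithinAt f (f' x) (Set.Ici 1) x)
    (hle : ∀ x, 1 ≤ x → |f' x| ≤ C * x ^ (-1 - β)) :
    |f s - f t| ≤ C / β * (s ^ (-β) - t ^ (-β)) := by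
  have h := abs_sub_le_mul_of_abs_deriv_le (f := f) (g := fun x => x ^ (-β)) (f' := f')
    (g' := fun x => -β * x ^ (-β - 1)) (C := C / β) hst
    (fun x hx => ((hf x (hs.trans hx.1)).mono fun y hy => hs.trans hy.1).continuousWithinAt)
    (fun x hx => (Real.continuousAt_rpow_const x _
      (Or.inl (by linarith [hx.1]))).continuousWithinAt)
    (fun x hx => (hf x (by linarith [hx.1])).hasDerivAt (Ici_mem_nhds (by linarith [hx.1])))
    (fun x hx => Real.hasDerivAt_rpow_const (Or.inl (by linarith [hx.1])))
    (fun x hx => by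
      have : 0 < x := by linarith [hx.1]
      exact (mul_neg_of_neg_of_pos (by linarith) (by positivity)).ne)
    (fun x hx => by
      have : 0 < x := by linarith [hx.1]
      rw [abs_mul, abs_neg, abs_of_pos hβ, abs_of_pos (a := x ^ (-β - 1)) (by positivity),
        ← mul_assoc, div_mul_cancel₀ _ hβ.ne', show -β - 1 = -1 - β by ring]
      exact hle x (by linarith [hx.1]))
  rwa [abs_of_nonneg (a := s ^ (-β) - t ^ (-β))
    (sub_nonneg.2 (Real.rpow_le_rpow_of_nonpos (by linarith) hst (by linarith)))] at h

/-- The mean value theorem, with `x ^ γ` smallest at the right endpoint. It supplies the separation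
of windings. -/
theorem le_abs_sub_of_le_abs_deriv {f f' : ℝ → ℝ} {γ c s t : ℝ} (hγ : γ ≤ 0) (hc : 0 ≤ c)
    (hs : 0 < s) (hst : s ≤ t) (hf : ∀ x, s ≤ x → HasDerivAt f (f' x) x)
    (hle : ∀ x, s ≤ x → c * x ^ γ ≤ |f' x|) :
    c * (t - s) * t ^ γ ≤ |f s - f t| := by
  rcases hst.eq_or_lt with rfl | hst
  · simp
  obtain ⟨x, hx, h⟩ := exists_hasDerivAt_eq_slope f f' hst
    (fun y hy => (hf y hy.1).continuousAt.continuousWithinAt) (fun y hy => hf y hy.1.le)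
  have h0 : 0 < t - s := by linarith
  rw [eq_div_iff h0.ne'] at h
  rw [abs_sub_comm, ← h, abs_mul, abs_of_pos h0]
  have h1 := hle x hx.1.le
  have h2 : t ^ γ ≤ x ^ γ := Real.rpow_le_rpow_of_nonpos (by linarith [hx.1]) hx.2.le hγ
  calc c * (t - s) * t ^ γ = c * t ^ γ * (t - s) := by ring
    _ ≤ c * x ^ γ * (t - s) := by gcongr
    _ ≤ _ := by gcongr

/-! ### The model spiral -/

/-- Box dimension of a spiral with `r' = A r ^ 3`, `φ' = ± 1`, `z' = z ^ p * h z`. -/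
theorem hasBoxDim_spiral {r φ z h : ℝ → ℝ} {p : ℕ} {A φ₀ τ : ℝ} (hp : 2 ≤ p) (hA : A ≠ 0)
    (hτ : |τ| = 1) (hh : Continuous h) (hh0 : h 0 ≠ 0) (hrpos : ∀ s, 1 ≤ s → 0 < r s)
    (hr : ∀ s, 1 ≤ s → HasDerivWithinAt r (r s ^ 3 * A) (Set.Ici 1) s)
    (hz : ∀ s, 1 ≤ s → HasDerivWithinAt z (z s ^ p * h (z s)) (Set.Ici 1) s)
    (hφ : ∀ s, 1 ≤ s → φ s = φ₀ + τ * s) (hz0 : Tendsto z atTop (𝓝 0))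
    (hne : ∃ s, 1 ≤ s ∧ z s ≠ 0) :
    HasBoxDim ((fun s => cylPoint (r s) (φ s) (z s)) '' Set.Ici 1)
      (1 + 1 / (2 * (1 + min ((p : ℝ) - 1)⁻¹ (1 / 2)))) := by
  have hrc : ContinuousOn r (Set.Ici 1) := fun s hs => (hr s hs).continuousWithinAt
  have hzc : ContinuousOn z (Set.Ici 1) := fun s hs => (hz s hs).continuousWithinAt
  have hr' : ∀ s, 1 < s → HasDerivAt r (r s ^ 3 * A) s := fun s hs =>
    (hr s hs.le).hasDerivAt (Ici_mem_nhds hs)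
  have hz' : ∀ s, 1 < s → HasDerivAt z (z s ^ p * h (z s)) s := fun s hs =>
    (hz s hs.le).hasDerivAt (Ici_mem_nhds hs)
  obtain ⟨s₁, hs₁, hzs₁⟩ := hne
  have hzne : ∀ᶠ s in atTop, z s ≠ 0 := by
    -- Along the solution the equation is linear, `z' = z * (z ^ (p-1) * h z)`, so `z` never
    -- vanishes after `s₁`.
    filter_upwards [eventually_ge_atTop s₁] with s hs
    have hsub : Set.Icc s₁ s ⊆ Set.Ici 1 := fun x hx => hs₁.trans hx.1
    refine ne_zero_of_deriv_eq_mul (q := fun s => z s ^ (p - 1) * h (z s)) hs (hzc.mono hsub)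
      (((hzc.mono hsub).pow _).mul (hh.comp_continuousOn (hzc.mono hsub))) (fun x hx => ?_) hzs₁
    have := hz' x (by linarith [hx.1])
    rwa [← mul_assoc, ← pow_succ', Nat.sub_add_cancel (by omega)]
  have hp1 : (1 : ℝ) ≤ (p : ℝ) - 1 := by
    have : (2 : ℝ) ≤ p := by exact_mod_cast hp
    linarith
  have hgt : ∀ᶠ s : ℝ in atTop, 1 < s := eventually_gt_atTop 1
  obtain ⟨c₁, C₁, hc₁, hC₁, has₁⟩ := abs_asymptotics_of_deriv_eq_pow_mul (p := 3) (w := r)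
    (H := fun _ => A) (by norm_num) hA (hgt.mono fun s hs => (hrpos s hs.le).ne')
    (hgt.mono hr') tendsto_const_nhds
  obtain ⟨c₂, C₂, hc₂, hC₂, has₂⟩ := abs_asymptotics_of_deriv_eq_pow_mul (w := z)
    (H := fun s => h (z s)) hp hh0 hzne (hgt.mono hz') ((hh.tendsto 0).comp hz0)
  have e3 : (((3 : ℕ) : ℝ) - 1)⁻¹ = 1 / 2 := by norm_num
  rw [e3] at has₁
  set α := ((p : ℝ) - 1)⁻¹ with hα
  have hα0 : 0 < α := by positivity
  set β := min α (1 / 2) with hβdef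
  have hβ0 : 0 < β := lt_min hα0 (by norm_num)
  have hβα : β ≤ α := min_le_left _ _
  have hβ2 : β ≤ 1 / 2 := min_le_right _ _
  have hpowc : ∀ γ : ℝ, ContinuousOn (fun s : ℝ => s ^ γ) (Set.Ici 1) := fun γ s hs =>
    (Real.continuousAt_rpow_const s γ
      (Or.inl (by linarith [Set.mem_Ici.1 hs]))).continuousWithinAt
  have hpow0 : ∀ γ : ℝ, ∀ s : ℝ, 1 ≤ s → 0 < s ^ γ := fun γ s hs =>
    Real.rpow_pos_of_pos (by linarith) _
  have hsqrt : ∀ s : ℝ, 1 ≤ s → s ^ (-(1 / 2) : ℝ) = 1 / √s := fun s hs => by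
    rw [Real.rpow_neg (by linarith), ← Real.sqrt_eq_rpow, one_div]
  obtain ⟨K₁, hK₁0, hK₁⟩ := exists_bound_of_eventually_bound hrc (hpowc (-(1 / 2)))
    (hpow0 _) (has₁.mono fun s hs => hs.2.1)
  obtain ⟨K₂, hK₂0, hK₂⟩ := exists_bound_of_eventually_bound (C := C₁)
    (F := fun s => r s ^ 3 * A) (by fun_prop) (hpowc (-1 - β)) (hpow0 _) (by
      filter_upwards [has₁, hgt] with s hs hs1
      refine hs.2.2.2.trans ?_
      gcongr
      exact hs1.le)
  obtain ⟨K₃, hK₃0, hK₃⟩ := exists_bound_of_eventually_bound (C := C₂)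
    (F := fun s => z s ^ p * h (z s)) ((hzc.pow p).mul (hh.comp_continuousOn hzc))
    (hpowc (-1 - β)) (hpow0 _) (by
      filter_upwards [has₂, hgt] with s hs hs1
      refine hs.2.2.2.trans ?_
      gcongr
      exact hs1.le)
  set C := max K₁ (max (K₂ / β) (K₃ / β))
  have hC0 : 0 < C := lt_max_of_lt_left hK₁0
  have hmono : ∀ s t : ℝ, 1 ≤ s → s ≤ t → 0 ≤ s ^ (-β) - t ^ (-β) := fun s t hs hst =>
    sub_nonneg.2 (Real.rpow_le_rpow_of_nonpos (by linarith) hst (by linarith))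
  have hdr : ∀ s t, 1 ≤ s → s ≤ t → |r s - r t| ≤ C * (s ^ (-β) - t ^ (-β)) :=
    fun s t hs hst => (abs_sub_le_rpow_neg_sub hβ0 hs hst hr hK₂).trans
      (mul_le_mul_of_nonneg_right ((le_max_left _ _).trans (le_max_right _ _)) (hmono s t hs hst))
  have hdz : ∀ s t, 1 ≤ s → s ≤ t → |z s - z t| ≤ C * (s ^ (-β) - t ^ (-β)) :=
    fun s t hs hst => (abs_sub_le_rpow_neg_sub hβ0 hs hst hz hK₃).trans
      (mul_le_mul_of_nonneg_right ((le_max_right _ _).trans (le_max_right _ _)) (hmono s t hs hst))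
  have hrb : ∀ s, 1 ≤ s → |r s| ≤ C / √s := fun s hs => by
    rw [← mul_one_div, ← hsqrt s hs]
    exact (hK₁ s hs).trans
      (mul_le_mul_of_nonneg_right (le_max_left _ _) (hpow0 _ s hs).le)
  obtain ⟨C', hup⟩ := volume_thickening_spiral_le (φ := φ) hβ0 hβ2 hC0 hrb hdr hdz
    (fun s t hs ht => by rw [hφ s hs, hφ t ht, add_sub_add_left_eq_sub, ← mul_sub, abs_mul, hτ,
      one_mul])
  obtain ⟨S, hS⟩ := eventually_atTop.1 (has₁.and (has₂.and hgt))
  set c := min c₁ c₂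
  have hc0 : 0 < c := lt_min hc₁ hc₂
  obtain ⟨c', hc', hlow⟩ := le_volume_thickening_spiral (r := r) (φ := φ) (z := z) (S := S)
    hβ0 hβ2 hc0 hτ
    (fun s hs => by
      obtain ⟨h1, -, h3⟩ := hS s hs
      rw [← mul_one_div, ← hsqrt s h3.le]
      rw [abs_of_pos (hrpos s h3.le)] at h1
      exact le_trans (mul_le_mul_of_nonneg_right (min_le_left _ _) (hpow0 _ s h3.le).le) h1.1)
    (fun s t hs hst => by
      have hs1 := (hS s hs).2.2
      -- The coordinate whose exponent attains the minimum `β` separates the windings: `z` if `β =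
      -- α`, `r` if `β = 1/2`.
      rcases min_choice α (1 / 2) with hb | hb
      · refine (le_abs_sub_of_le_abs_deriv (by linarith) hc0.le (by linarith) hst
          (fun x hx => hz' x (by linarith)) (fun x hx => ?_)).trans
          (le_add_of_nonneg_left (abs_nonneg (r s - r t)))
        rw [hβdef, hb]
        exact le_trans (mul_le_mul_of_nonneg_right (min_le_right _ _)
          (hpow0 _ x (by linarith)).le) (hS x (hs.trans hx)).2.1.2.2.1
      · refine (le_abs_sub_of_le_abs_deriv (by linarith) hc0.le (by linarith) hst
          (fun x hx => hr' x (by linarith)) (fun x hx => ?_)).trans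
          (le_add_of_nonneg_right (abs_nonneg (z s - z t)))
        rw [hβdef, hb]
        exact le_trans (mul_le_mul_of_nonneg_right (min_le_left _ _)
          (hpow0 _ x (by linarith)).le) (hS x (hs.trans hx)).1.2.2.1) hφ
  have hexp : ((3 : ℕ) : ℝ) - (1 + 1 / (2 * (1 + β))) = 2 - 1 / (2 * (1 + β)) := by
    push_cast; ring
  refine hasBoxDim_of_volume_bounds (c := c') (C := C') ?_ (by positivity) hc' ?_ ?_
  · refine isBounded_iff_forall_norm_le.2 ⟨C + (|z 1| + C), ?_⟩
    rintro _ ⟨s, hs, rfl⟩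
    have hs : 1 ≤ s := hs
    have h1 : |r s| ≤ C := (hrb s hs).trans (div_le_self hC0.le (Real.one_le_sqrt.2 hs))
    have h2 : |z s| ≤ |z 1| + C := by
      have h3 := hdz 1 s le_rfl hs
      rw [Real.one_rpow] at h3
      have h4 : C * (1 - s ^ (-β)) ≤ C := by nlinarith [hpow0 (-β) s hs]
      have h5 := abs_sub_abs_le_abs_sub (z s) (z 1)
      rw [abs_sub_comm] at h5
      linarith
    exact (norm_cylPoint_le _ _ _).trans (by linarith)
  · rw [hexp]; exact hlow
  · rw [hexp]
    filter_upwards [self_mem_nhdsWithin,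
      nhdsWithin_le_nhds (eventually_le_nhds one_pos)] with ε hε h1
    exact hup ε hε h1

/-! ### Existence of spirals through given points -/

/-- Forward solutions of `w' = -g w` with `0 < g w ≤ C * w ^ 2` near `0` exist for all times and
tend to `0`. -/
theorem exists_decaying_solution {g : ℝ → ℝ} {D C w₀ : ℝ} (hg : ContinuousOn g (Set.Ioo 0 D))
    (hpos : ∀ w ∈ Set.Ioo 0 D, 0 < g w) (hle : ∀ w ∈ Set.Ioo 0 D, g w ≤ C * w ^ 2)
    (hw₀ : w₀ ∈ Set.Ioo 0 D) :
    ∃ w : ℝ → ℝ, w 0 = w₀ ∧ (∀ s, 0 ≤ s → w s ∈ Set.Ioo 0 D ∧ HasDerivAt w (-g (w s)) s) ∧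
      Tendsto w atTop (𝓝 0) := by
  have hC : 0 < C := by
    have h1 := (hpos w₀ hw₀).trans_le (hle w₀ hw₀)
    have h2 : 0 < w₀ ^ 2 := pow_pos hw₀.1 2
    exact pos_of_mul_pos_left h1 h2.le
  -- The base point lies beyond `w₀`, so the starting time `G w₀` is positive and the solution has a
  -- two-sided derivative there.
  set w₁ := (w₀ + D) / 2 with hw₁def
  have hw₀₁ : w₀ < w₁ := by linarith [hw₀.2]
  have hw₁ : w₁ ∈ Set.Ioo 0 D := ⟨by linarith [hw₀.1], by linarith [hw₀.2]⟩
  have hginv : ContinuousOn (fun u => (g u)⁻¹) (Set.Ioo 0 D) :=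
    hg.inv₀ fun x hx => (hpos x hx).ne'
  -- Separation of variables: `G x` is the time taken to descend from `w₁` to `x`. As `g u ≤ C u²`,
  -- it is unbounded near `0`, so its inverse `W` exists for all positive times.
  set G : ℝ → ℝ := fun x => ∫ u in x..w₁, (g u)⁻¹ with hG
  have hGd : ∀ x ∈ Set.Ioo 0 D, HasDerivAt G (-(g x)⁻¹) x := by
    intro x hx
    refine intervalIntegral.integral_hasDerivAt_left ?_
      (hginv.stronglyMeasurableAtFilter isOpen_Ioo x hx)
      (hginv.continuousAt (isOpen_Ioo.mem_nhds hx))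
    exact (hginv.mono (Set.ordConnected_Ioo.uIcc_subset hx hw₁)).intervalIntegrable
  have hGc : ContinuousOn G (Set.Ioo 0 D) := fun x hx =>
    (hGd x hx).continuousAt.continuousWithinAt
  have hanti : StrictAntiOn G (Set.Ioo 0 D) := by
    refine strictAntiOn_of_deriv_neg (convex_Ioo 0 D) hGc fun x hx => ?_
    rw [interior_Ioo] at hx
    rw [(hGd x hx).deriv]
    exact neg_neg_of_pos (inv_pos.2 (hpos x hx))
  have hG₁ : G w₁ = 0 := intervalIntegral.integral_same
  have hGlow : ∀ x ∈ Set.Ioc 0 w₁, (C * x)⁻¹ - (C * w₁)⁻¹ ≤ G x := by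
    have hEd : ∀ x ∈ Set.Ioo 0 D, HasDerivAt (fun x => G x - C⁻¹ * x⁻¹)
        (-(g x)⁻¹ - C⁻¹ * -(x ^ 2)⁻¹) x := fun x hx =>
      (hGd x hx).sub ((hasDerivAt_inv hx.1.ne').const_mul _)
    have hE : AntitoneOn (fun x => G x - C⁻¹ * x⁻¹) (Set.Ioo 0 D) := by
      refine antitoneOn_of_deriv_nonpos (convex_Ioo 0 D)
        (fun x hx => (hEd x hx).continuousAt.continuousWithinAt)
        (fun x hx => ?_) (fun x hx => ?_)
      · rw [interior_Ioo] at hx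
        exact (hEd x hx).differentiableAt.differentiableWithinAt
      · rw [interior_Ioo] at hx
        rw [(hEd x hx).deriv]
        have : (C * x ^ 2)⁻¹ ≤ (g x)⁻¹ := inv_anti₀ (hpos x hx) (hle x hx)
        rw [mul_inv] at this
        linarith
    intro x hx
    have := hE ⟨hx.1, hx.2.trans_lt hw₁.2⟩ hw₁ hx.2
    simp only [hG₁] at this
    rw [mul_inv, mul_inv]
    linarith
  have hsurj : ∀ t, ∃ y ∈ Set.Ioo 0 D, 0 < t → G y = t := by
    intro t
    by_cases ht : 0 < t
    -- The point `k⁻¹` is where the lower bound `(C x)⁻¹ - (C w₁)⁻¹` for `G` equals `t`.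
    · set k := C * (t + (C * w₁)⁻¹) with hk
      have hw₁0 := hw₁.1
      have hk1 : w₁⁻¹ ≤ k := by
        have : k = C * t + w₁⁻¹ := by rw [hk]; field_simp
        rw [this]
        have : 0 < C * t := by positivity
        linarith
      have hk0 : 0 < k := (inv_pos.2 hw₁0).trans_le hk1
      have hx : k⁻¹ ∈ Set.Ioc 0 w₁ := ⟨inv_pos.2 hk0, inv_le_of_inv_le₀ hw₁0 hk1⟩
      have hGx : t ≤ G k⁻¹ := by
        refine le_trans (le_of_eq ?_) (hGlow _ hx)
        rw [mul_inv, inv_inv, hk]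
        field_simp
        ring
      obtain ⟨y, hy, hyt⟩ := intermediate_value_Icc' hx.2
        (hGc.mono fun y hy => ⟨hx.1.trans_le hy.1, hy.2.trans_lt hw₁.2⟩)
        (show t ∈ Set.Icc (G w₁) (G k⁻¹) from ⟨by rw [hG₁]; exact ht.le, hGx⟩)
      exact ⟨y, ⟨hx.1.trans_le hy.1, hy.2.trans_lt hw₁.2⟩, fun _ => hyt⟩
    · exact ⟨w₁, hw₁, fun h => absurd h ht⟩
  choose W hWmem hW using hsurj
  have hWc : ∀ t, 0 < t → ContinuousAt W t := by
    intro t ht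
    have hm := hWmem t
    refine tendsto_order.2 ⟨fun a ha => ?_, fun a ha => ?_⟩
    · have ha' : max a (W t / 2) ∈ Set.Ioo 0 D :=
        ⟨lt_max_of_lt_right (by linarith [hm.1]), max_lt (ha.trans hm.2) (by linarith [hm.1, hm.2])⟩
      have h1 : t < G (max a (W t / 2)) := by
        conv_lhs => rw [← hW t ht]
        exact hanti ha' hm (max_lt ha (by linarith [hm.1]))
      filter_upwards [eventually_gt_nhds ht, eventually_lt_nhds h1] with s hs0 hs
      rw [← hW s hs0] at hs
      exact (le_max_left _ _).trans_lt ((hanti.lt_iff_gt (hWmem s) ha').1 hs)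
    · have ha' : min a ((W t + D) / 2) ∈ Set.Ioo 0 D :=
        ⟨lt_min (hm.1.trans ha) (by linarith [hm.1, hm.2]), min_lt_of_right_lt (by linarith [hm.2])⟩
      have h1 : G (min a ((W t + D) / 2)) < t := by
        conv_rhs => rw [← hW t ht]
        exact hanti hm ha' (lt_min ha (by linarith [hm.2]))
      filter_upwards [eventually_gt_nhds ht, eventually_gt_nhds h1] with s hs0 hs
      rw [← hW s hs0] at hs
      exact ((hanti.lt_iff_gt ha' (hWmem s)).1 hs).trans_le (min_le_left _ _)
  have hWd : ∀ t, 0 < t → HasDerivAt W (-g (W t)) t := by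
    intro t ht
    have := HasDerivAt.of_local_left_inverse (hWc t ht) (hGd _ (hWmem t))
      (neg_ne_zero.2 (inv_ne_zero (hpos _ (hWmem t)).ne'))
      ((eventually_gt_nhds ht).mono fun s hs => hW s hs)
    rwa [inv_neg, inv_inv] at this
  have hWlim : Tendsto W atTop (𝓝 0) := by
    refine tendsto_order.2 ⟨fun a ha => Eventually.of_forall fun s => ha.trans (hWmem s).1,
      fun a ha => ?_⟩
    have ha' : min a w₁ ∈ Set.Ioo 0 D := ⟨lt_min ha hw₁.1, min_lt_of_right_lt hw₁.2⟩
    filter_upwards [eventually_gt_atTop 0, eventually_gt_atTop (G (min a w₁))] with s hs0 hs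
    rw [← hW s hs0] at hs
    exact ((hanti.lt_iff_gt ha' (hWmem s)).1 hs).trans_le (min_le_left _ _)
  have hG₀ : 0 < G w₀ := hG₁ ▸ hanti hw₀ hw₁ hw₀₁
  refine ⟨fun s => W (s + G w₀), ?_, fun s hs => ⟨hWmem _, ?_⟩, ?_⟩
  · simp only [zero_add]
    exact hanti.injOn (hWmem _) hw₀ (hW _ hG₀)
  · exact (hWd (s + G w₀) (by linarith)).comp_add_const s (G w₀)
  · exact hWlim.comp (tendsto_atTop_add_const_right _ _ tendsto_id)

/-- A polynomial without terms of order below `p` is `z ^ p` times a continuous function. -/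
theorem exists_continuous_factor {n p : ℕ} (hp : 2 ≤ p) (hpn : p ≤ n) (b : ℕ → ℝ)
    (hb : ∀ i, 2 ≤ i → i < p → b i = 0) :
    ∃ h : ℝ → ℝ, Continuous h ∧ h 0 = b p ∧
      ∀ z, ∑ i ∈ Finset.Icc 2 n, b i * z ^ i = z ^ p * h z := by
  refine ⟨fun z => ∑ i ∈ Finset.Icc p n, b i * z ^ (i - p), by fun_prop, ?_, fun z => ?_⟩
  · simp only
    rw [Finset.sum_eq_single_of_mem p (Finset.mem_Icc.2 ⟨le_rfl, hpn⟩)]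
    · simp
    · intro i hi hne
      rw [zero_pow (by have := (Finset.mem_Icc.1 hi).1; omega), mul_zero]
  · rw [Finset.mul_sum, ← Finset.sum_subset (Finset.Icc_subset_Icc_left hp)]
    · refine Finset.sum_congr rfl fun i hi => ?_
      rw [mul_left_comm, ← pow_add, Nat.add_sub_cancel' (Finset.mem_Icc.1 hi).1]
    · intro i hi hni
      rw [Finset.mem_Icc] at hi hni
      rw [hb i hi.1 (by by_contra! h; exact hni ⟨h, hi.2⟩), zero_mul]

theorem tendsto_cylPoint_zero {ι : Type*} {F : Filter ι} {r φ z : ι → ℝ} (hr : Tendsto r F (𝓝 0))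
    (hz : Tendsto z F (𝓝 0)) : Tendsto (fun t => cylPoint (r t) (φ t) (z t)) F (𝓝 0) := by
  refine squeeze_zero_norm (fun t => norm_cylPoint_le _ _ _) ?_
  simpa using hr.abs.add hz.abs

theorem radial_field_eq {σ : ℝ} {a : Fin 1 → ℝ} (ha : a 0 = 0) (x : ℝ) :
    σ * (x * (x ^ (2 * 1) + ∑ i : Fin 1, a i * x ^ (2 * (i : ℕ)))) = x ^ 3 * σ := by
  simp [ha]; ring

/-- Every point near the origin with `σ b_p z ^ (p - 1) > 0` lies on a spatial spiral. -/
theorem exists_isSpatialSpiral {σ : ℝ} (hσ : σ = 1 ∨ σ = -1) {a : Fin 1 → ℝ} (ha : a 0 = 0)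
    {n p : ℕ} (hp : 2 ≤ p) (hpn : p ≤ n) {b : ℕ → ℝ}
    (hb : ∀ i, 2 ≤ i → i < p → b i = 0) (hbp : b p < 0) :
    ∃ δ : ℝ, 0 < δ ∧ ∀ r₀ φ₀ z₀ : ℝ, 0 < r₀ → r₀ < δ → |z₀| < δ → 0 < σ * b p * z₀ ^ (p - 1) →
      ∃ Γ, cylPoint r₀ φ₀ z₀ ∈ Γ ∧ IsSpatialSpiral σ 1 a n b Γ := by
  obtain ⟨h, hh, hh0, hf⟩ := exists_continuous_factor hp hpn b hb
  have hev : ∀ᶠ z in 𝓝 (0 : ℝ), h z < 0 ∧ 2 * b p < h z := by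
    have := hh.tendsto 0
    rw [hh0] at this
    exact (this.eventually (eventually_lt_nhds hbp)).and
      (this.eventually (eventually_gt_nhds (by linarith)))
  obtain ⟨δ', hδ', hδh⟩ := Metric.eventually_nhds_iff.1 hev
  simp only [Real.dist_eq, sub_zero] at hδh
  set D := min δ' 1
  have hD0 : 0 < D := lt_min hδ' one_pos
  refine ⟨D, hD0, fun r₀ φ₀ z₀ hr₀ hr₀D hz₀D hz₀ => ?_⟩
  have hz₀ne : z₀ ≠ 0 := by
    rintro rfl
    rw [zero_pow (by omega), mul_zero] at hz₀
    exact lt_irrefl _ hz₀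
  obtain ⟨η, hη, hηz⟩ : ∃ η : ℝ, (η = 1 ∨ η = -1) ∧ z₀ = η * |z₀| := by
    rcases le_total 0 z₀ with h0 | h0
    · exact ⟨1, Or.inl rfl, by rw [abs_of_nonneg h0, one_mul]⟩
    · exact ⟨-1, Or.inr rfl, by rw [abs_of_nonpos h0]; ring⟩
  have hηabs : |η| = 1 := by rcases hη with rfl | rfl <;> simp
  -- This is where the sign condition on `z₀` enters. It gives `η ^ p = -σ η`, so `z t = η w(-σ t)`
  -- with `w' = h(η w) w ^ p` satisfies `z' = z ^ p h z`. The time `-σ t` increases towards the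
  -- origin for both coordinates.
  have hηp : η ^ (p - 1) = -σ := by
    rw [hηz, mul_pow] at hz₀
    have h1 : 0 < |z₀| ^ (p - 1) := by positivity
    have h2 : 0 < σ * b p * η ^ (p - 1) := by
      rw [← mul_assoc] at hz₀
      exact pos_of_mul_pos_left hz₀ h1.le
    have h3 : η ^ (p - 1) = 1 ∨ η ^ (p - 1) = -1 := by
      rcases hη with rfl | rfl
      · exact Or.inl (one_pow _)
      · exact neg_one_pow_eq_or ℝ _
    rcases hσ with rfl | rfl <;> rcases h3 with h3 | h3 <;> rw [h3] at h2 ⊢ <;> linarith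
  have hηp' : η ^ p = -σ * η := by
    rw [← hηp, ← pow_succ, Nat.sub_add_cancel (by omega)]
  obtain ⟨ρ, hρ0, hρ, hρlim⟩ := exists_decaying_solution (g := fun w => w ^ 3) (D := D) (C := 1)
    (w₀ := r₀) (by fun_prop) (fun w hw => pow_pos hw.1 3) (fun w hw => by
      have h1 : w < 1 := hw.2.trans_le (min_le_right _ _)
      nlinarith [sq_nonneg w]) ⟨hr₀, hr₀D⟩
  have hsmall : ∀ w ∈ Set.Ioo 0 D, h (η * w) < 0 ∧ 2 * b p < h (η * w) := fun w hw => by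
    refine hδh ?_
    rw [abs_mul, hηabs, one_mul, abs_of_pos hw.1]
    exact hw.2.trans_le (min_le_left _ _)
  obtain ⟨w, hw0, hw, hwlim⟩ := exists_decaying_solution (g := fun w => -h (η * w) * w ^ p)
    (D := D) (C := -2 * b p) (w₀ := |z₀|) (by fun_prop)
    (fun w hw => mul_pos (neg_pos.2 (hsmall w hw).1) (pow_pos hw.1 p))
    (fun w hw => by
      have h1 : w < 1 := hw.2.trans_le (min_le_right _ _)
      have h2 : w ^ p ≤ w ^ 2 := pow_le_pow_of_le_one hw.1.le h1.le hp
      have h3 := (hsmall w hw).2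
      have h4 := hw.1
      exact mul_le_mul (by linarith) h2 (by positivity) (by linarith)) ⟨abs_pos.2 hz₀ne, hz₀D⟩
  obtain ⟨J, F, hJF, hJ, hF, h0J⟩ : ∃ (J : Set ℝ) (F : Filter ℝ),
      ((∃ t₀, J = Set.Ici t₀ ∧ F = atTop) ∨ (∃ t₀, J = Set.Iic t₀ ∧ F = atBot)) ∧
      (∀ t ∈ J, 0 ≤ -σ * t) ∧ Tendsto (fun t => -σ * t) F atTop ∧ (0 : ℝ) ∈ J := by
    rcases hσ with rfl | rfl
    · refine ⟨Set.Iic 0, atBot, Or.inr ⟨0, rfl, rfl⟩, fun t ht => ?_, ?_, Set.mem_Iic.2 le_rfl⟩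
      · have : t ≤ 0 := ht
        linarith
      · simpa using tendsto_neg_atBot_atTop (G := ℝ)
    · refine ⟨Set.Ici 0, atTop, Or.inl ⟨0, rfl, rfl⟩, fun t ht => ?_, ?_, Set.mem_Ici.2 le_rfl⟩
      · have : 0 ≤ t := ht
        linarith
      · simp only [neg_neg, one_mul]; exact tendsto_id
  have hlin : ∀ t : ℝ, HasDerivAt (fun t => -σ * t) (-σ) t := fun t => by
    simpa using (hasDerivAt_id t).const_mul (-σ)
  refine ⟨(fun t => cylPoint (ρ (-σ * t)) (φ₀ + t) (η * w (-σ * t))) '' J,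
    ⟨0, h0J, ?_⟩, J, F, fun t => ρ (-σ * t), fun t => φ₀ + t, fun t => η * w (-σ * t), hJF,
    ⟨fun t ht => (hρ _ (hJ t ht)).1.1, fun t ht => ?_, fun t ht => ?_, fun t ht => ?_⟩,
    ?_, ⟨0, h0J, ?_⟩, rfl⟩
  · simp only [mul_zero, add_zero, hρ0, hw0, ← hηz]
  · rw [radial_field_eq ha]
    have := (hρ _ (hJ t ht)).2.comp t (hlin t)
    refine (this.congr_deriv ?_).hasDerivWithinAt
    ring
  · simpa using ((hasDerivAt_id t).const_add φ₀).hasDerivWithinAt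
  · rw [hf]
    have := ((hw _ (hJ t ht)).2.comp t (hlin t)).const_mul η
    refine (this.congr_deriv ?_).hasDerivWithinAt
    rw [mul_pow, hηp']
    ring
  · refine tendsto_cylPoint_zero (hρlim.comp hF) ?_
    simpa using (hwlim.comp hF).const_mul η
  · simp only [mul_zero, hw0, ← hηz]
    exact hz₀ne

/-! ### Reduction to the model spiral and the final exponents -/

/-- The affine change `t = t₀ + τ (s - 1)`, `τ = ±1`, carries `[1, ∞)` onto either kind of
half-line; the sign is absorbed into `A = τ σ` and `τ h`. Convergence to the origin is part of the
definition, so the sign of `b p` plays no role. -/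
theorem IsSpatialSpiral.hasBoxDim {σ : ℝ} (hσ : σ = 1 ∨ σ = -1) {a : Fin 1 → ℝ} (ha : a 0 = 0)
    {n p : ℕ} (hp : 2 ≤ p) (hpn : p ≤ n) {b : ℕ → ℝ}
    (hb : ∀ i, 2 ≤ i → i < p → b i = 0) (hbp : b p ≠ 0) {Γ : Set (EuclideanSpace ℝ (Fin 3))}
    (hΓ : IsSpatialSpiral σ 1 a n b Γ) :
    HasBoxDim Γ (1 + 1 / (2 * (1 + min ((p : ℝ) - 1)⁻¹ (1 / 2)))) := by
  obtain ⟨J, F, r, φ, z, hJF, hsol, hlim, ⟨t₁, ht₁, hzt₁⟩, rfl⟩ := hΓ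
  obtain ⟨h, hh, hh0, hf⟩ := exists_continuous_factor hp hpn b hb
  obtain ⟨τ, t₀, hτ, hJ, hF⟩ : ∃ τ t₀ : ℝ, (τ = 1 ∨ τ = -1) ∧
      (∀ t, t ∈ J ↔ 1 ≤ 1 + τ * (t - t₀)) ∧ Tendsto (fun s => t₀ + τ * (s - 1)) atTop F := by
    rcases hJF with ⟨t₀, rfl, rfl⟩ | ⟨t₀, rfl, rfl⟩
    · refine ⟨1, t₀, Or.inl rfl, fun t => ?_, ?_⟩
      · rw [Set.mem_Ici]; constructor <;> intro h <;> linarith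
      · simp only [one_mul]
        exact tendsto_atTop_add_const_left _ _ (tendsto_atTop_add_const_right _ _ tendsto_id)
    · refine ⟨-1, t₀, Or.inr rfl, fun t => ?_, ?_⟩
      · rw [Set.mem_Iic]; constructor <;> intro h <;> linarith
      · simp only [neg_one_mul]
        exact tendsto_atBot_add_const_left _ _ (tendsto_neg_atTop_atBot.comp
          (tendsto_atTop_add_const_right _ _ tendsto_id))
  have hττ : τ * τ = 1 := by rcases hτ with rfl | rfl <;> norm_num
  have hτabs : |τ| = 1 := by rcases hτ with rfl | rfl <;> simp
  have hτ0 : τ ≠ 0 := by rcases hτ with rfl | rfl <;> norm_num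
  have hσ0 : σ ≠ 0 := by rcases hσ with rfl | rfl <;> norm_num
  set ζ : ℝ → ℝ := fun s => t₀ + τ * (s - 1) with hζ
  have hζJ : ∀ s, 1 ≤ s → ζ s ∈ J := fun s hs => by
    rw [hJ, hζ]
    linear_combination hs - (s - 1) * hττ
  have hmaps : Set.MapsTo ζ (Set.Ici 1) J := hζJ
  have himg : ζ '' Set.Ici 1 = J := by
    refine Set.Subset.antisymm hmaps.image_subset fun t ht => ⟨1 + τ * (t - t₀), (hJ t).1 ht, ?_⟩
    simp only [hζ]
    linear_combination (t - t₀) * hττ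
  have hζd : ∀ s, HasDerivWithinAt ζ τ (Set.Ici 1) s := fun s => by
    have := (((hasDerivAt_id s).sub_const 1).const_mul τ).const_add t₀
    exact (this.congr_deriv (mul_one τ)).hasDerivWithinAt
  have hzlim : Tendsto z F (𝓝 0) :=
    squeeze_zero_norm (fun t => (abs_le_norm_cylPoint (r t) (φ t) (z t)).2)
      (by simpa using hlim.norm)
  have hφ : ∀ s, 1 ≤ s → φ (ζ s) = (φ (ζ 1) - τ) + τ * s := by
    intro s hs
    -- `φ (ζ x) - τ x` has zero derivative, hence equals its value at `x = 1`.
    have hd : ∀ x ∈ Set.Ici (1 : ℝ), HasDerivWithinAt (fun x => φ (ζ x) - τ * x) 0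
        (Set.Ici 1) x := fun x hx => by
      have h1 := (hsol.deriv_φ _ (hζJ x hx)).comp x (hζd x) hmaps
      have h2 := h1.sub ((hasDerivWithinAt_id x (Set.Ici 1)).const_mul τ)
      refine (h2.congr_deriv ?_)
      ring
    have := (convex_Ici (1 : ℝ)).norm_image_sub_le_of_norm_hasDerivWithin_le (C := 0) hd
      (fun x _ => by simp) (Set.mem_Ici.2 le_rfl) (Set.mem_Ici.2 hs)
    rw [zero_mul] at this
    have := norm_le_zero_iff.1 this
    linarith
  have key := hasBoxDim_spiral (r := fun s => r (ζ s)) (φ := fun s => φ (ζ s))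
    (z := fun s => z (ζ s)) (h := fun x => τ * h x) (A := τ * σ) hp (mul_ne_zero hτ0 hσ0) hτabs
    (by fun_prop) (by simpa [hh0] using ⟨hτ0, hbp⟩) (fun s hs => hsol.r_pos _ (hζJ s hs))
    (fun s hs => by
      have h1 := hsol.deriv_r _ (hζJ s hs)
      rw [radial_field_eq ha] at h1
      refine (h1.comp s (hζd s) hmaps).congr_deriv ?_
      ring)
    (fun s hs => by
      have h1 := hsol.deriv_z _ (hζJ s hs)
      rw [hf] at h1
      refine (h1.comp s (hζd s) hmaps).congr_deriv ?_
      ring) hφ (hzlim.comp hF)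
    (by
      obtain ⟨s, hs, rfl⟩ : t₁ ∈ ζ '' Set.Ici 1 := himg ▸ ht₁
      exact ⟨s, hs, hzt₁⟩)
  rw [← himg, Set.image_image]
  exact key

theorem theorem4 (σ : ℝ) (hσ : σ = 1 ∨ σ = -1) (a : Fin 1 → ℝ) (ha : a 0 = 0)
    (n p : ℕ) (hp : 2 ≤ p) (hpn : p ≤ n) (b : ℕ → ℝ)
    (hb : ∀ i, 2 ≤ i → i < p → b i = 0) (hbp : b p < 0) :
    (∃ δ : ℝ, 0 < δ ∧ ∀ r₀ φ₀ z₀ : ℝ, 0 < r₀ → r₀ < δ → |z₀| < δ → 0 < σ * b p * z₀ ^ (p - 1) →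
      ∃ Γ, cylPoint r₀ φ₀ z₀ ∈ Γ ∧ IsSpatialSpiral σ 1 a n b Γ) ∧
    (∀ Γ, IsSpatialSpiral σ 1 a n b Γ →
      (p ≤ 3 → HasBoxDim Γ (4 / 3)) ∧
      (4 ≤ p → HasBoxDim Γ (3 / 2 - 1 / (2 * (p : ℝ))))) := by
  refine ⟨exists_isSpatialSpiral hσ ha hp hpn hb hbp, fun Γ hΓ => ?_⟩
  have key := hΓ.hasBoxDim hσ ha hp hpn hb hbp.ne
  have hp2 : (2 : ℝ) ≤ p := by exact_mod_cast hp
  have hp1 : 0 < (p : ℝ) - 1 := by linarith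
  refine ⟨fun h3 => ?_, fun h4 => ?_⟩
  · have h3' : (p : ℝ) ≤ 3 := by exact_mod_cast h3
    have hmin : 1 / 2 ≤ ((p : ℝ) - 1)⁻¹ := by
      rw [one_div]; exact inv_anti₀ hp1 (by linarith)
    rw [min_eq_right hmin] at key
    convert key using 1
    norm_num
  · have h4' : (4 : ℝ) ≤ p := by exact_mod_cast h4
    have hmin : ((p : ℝ) - 1)⁻¹ ≤ 1 / 2 := by
      rw [one_div]; exact inv_anti₀ two_pos (by linarith)
    -- Here `β = 1/(p-1)`, so `1 + β = p/(p-1)` and the dimension is `1 + (p-1)/(2p)`.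
    rw [min_eq_left hmin] at key
    convert key using 1
    field_simp
    ring
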